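/- Let $a\le b$ be real numbers. **Measures.** Let $\widetilde{\mathcal M}[a,b]$ be the set of probability measures $\psi$ on $\mathbb R$ that are supported on $[a,b]$ and have a density with respect to Lebesgue measure with values in $[0,1]$. Write $\psi_k=\int t^k\,d\psi(t)$ for $k\ge 0$, and for $u\in\mathbb C\setminus[a,b]$ put $$R_\psi(u)=-1+\exp\int_a^b\frac{d\psi(t)}{u-t}.$$ **Diagrams.** A continual Young diagram is a function $w:\mathbb R\to\mathbb R$ with $|w(x_1)-w(x_2)|\le|x_1-x_2|$ for all $x_1,x_2$ for which there is an $x_0\in\mathbb R$ such that $w(x)=|x-x_0|$ whenever $|x|$ is sufficiently large. Let $\mathcal D[a,b]$ be the set of continual Young diagrams for which there is an $x_0\in[a,b]$ with $w(x)=|x-x_0|$ for all $x\notin[a,b]$. For $w\in\mathcal D[a,b]$ and $k\ge1$ let $$p_k(w)=\frac12\int_a^b t^k\,w''(t)\,dt,$$ where $w''$ is the second derivative of $w$ in the sense of distributions (it is supported on $[a,b]$, and the integral denotes its value at a smooth compactly supported function equal to $t^k$ near $[a,b]$). Let $c$ be the point of $[a,b]$ nearest to $0$ (so $c=0$ if $0\in[a,b]$),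 put $\sigma_c(x)=\frac12(w(x)-|x-c|)$, and for $u\in\mathbb C\setminus[a,b]$ put $$R_w(u)=\frac1{u-c}\exp\int_a^b\frac{d\sigma_c(t)}{t-u}.$$ Let $\widetilde{\mathcal D}[a,b]$ be the set of $w\in\mathcal D[a,b]$ with $R_w(u)>-1$ for all real $u\notin[a,b]$. **Theorem (quantized Markov–Krein correspondence).** There is a bijection between $\widetilde{\mathcal M}[a,b]$ and $\widetilde{\mathcal D}[a,b]$ under which $\psi\in\widetilde{\mathcal M}[a,b]$ corresponds to $w\in\widetilde{\mathcal D}[a,b]$ if and only if $$\frac1z\left(-1+\exp\left(z\sum_{k=0}^\infty\psi_kz^k\right)\right)=\exp\left(\sum_{k=1}^\infty\frac{p_k(w)}k z^k\right)$$ for all complex $z\ne0$ in some neighbourhood of $0$ (in which both series converge). Moreover, for $\psi\in\widetilde{\mathcal M}[a,b]$ and $w\in\widetilde{\mathcal D}[a,b]$, this relation holds if and only if $R_\psi(u)=R_w(u)$ for all $u\in\mathbb C\setminus[a,b]$. -/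

import Mathlib

open MeasureTheory Filter Topology

/-- `BoundedDensityMeasures a b`: Borel probability measures on `ℝ` supported on `[a, b]` which have
a density with respect to Lebesgue measure taking values in `[0, 1]`. -/
def BoundedDensityMeasures (a b : ℝ) : Set (Measure ℝ) :=
  {ψ | IsProbabilityMeasure ψ ∧ ψ (Set.Icc a b)ᶜ = 0 ∧
    ∃ f : ℝ → ℝ, Measurable f ∧ (∀ x, 0 ≤ f x ∧ f x ≤ 1) ∧
      ψ = volume.withDensity (fun x => ENNReal.ofReal (f x))}

/-- Continual Young diagrams: 1-Lipschitz functions `w` such that, for some `x₀`,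
`w x = |x - x₀|` whenever `|x|` is sufficiently large. -/
def IsContinualYoungDiagram (w : ℝ → ℝ) : Prop :=
  (∀ x₁ x₂ : ℝ, |w x₁ - w x₂| ≤ |x₁ - x₂|) ∧
    ∃ x₀ R : ℝ, ∀ x : ℝ, R ≤ |x| → w x = |x - x₀|

/-- `Diagrams a b`: continual Young diagrams with `w x = |x - x₀|` off `[a, b]`. The centre `x₀` lies
in `[a, b]`, i.e. the second derivative of `w` vanishes outside `[a, b]`. -/
def Diagrams (a b : ℝ) : Set (ℝ → ℝ) :=
  {w | IsContinualYoungDiagram w ∧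
    ∃ x₀ ∈ Set.Icc a b, ∀ x : ℝ, x ∉ Set.Icc a b → w x = |x - x₀|}

/-- The `k`-th moment of a measure. -/
noncomputable def measureMoment (ψ : Measure ℝ) (k : ℕ) : ℝ := ∫ t, t ^ k ∂ψ

/-- The pairing `⟨w'', φ⟩ = ∫ w φ''` of the second distributional derivative of `w` with a test
function `φ`. -/
noncomputable def secondDerivPairing (w φ : ℝ → ℝ) : ℝ := ∫ x, w x * deriv (deriv φ) x

/-- A smooth compactly supported function equal to `1` on a neighbourhood of `[a, b]`. -/
noncomputable def intervalCutoff (a b : ℝ) : ContDiffBump ((a + b) / 2) where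
  rIn := |b - a| / 2 + 1
  rOut := |b - a| / 2 + 2
  rIn_pos := by positivity
  rIn_lt_rOut := by linarith

/-- `p_k(w) = (1/2) ∫_a^b t ^ k w''(t) dt`. For a general diagram `w''` is a distribution supported on
`[a, b]`, and the integral is its value at `t ^ k`, cut off away from `[a, b]`.
See `diagramMoment_eq` for the independence of the cutoff. -/
noncomputable def diagramMoment (a b : ℝ) (w : ℝ → ℝ) (k : ℕ) : ℝ :=
  (1 / 2) * secondDerivPairing w (fun t => intervalCutoff a b t * t ^ k)

/-- The `R`-function of a measure with density at most one:
`R_ψ(u) = -1 + exp (∫_a^b dψ(t) / (u - t))`. -/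
noncomputable def measureR (a b : ℝ) (ψ : Measure ℝ) (u : ℂ) : ℂ :=
  -1 + Complex.exp (∫ t in Set.Icc a b, 1 / (u - (t : ℂ)) ∂ψ)

/-- The point of `[a, b]` closest to `0`; it is `0` itself when `0 ∈ [a, b]`. -/
noncomputable def basePoint (a b : ℝ) : ℝ := max a (min 0 b)

/-- `σ_c(x) = (w(x) - |x - c|) / 2`. -/
noncomputable def diagramSigma (c : ℝ) (w : ℝ → ℝ) (x : ℝ) : ℝ := (w x - |x - c|) / 2

/-- The `R`-function of a diagram, `R_w(u) = 1 / (u - c) * exp (∫_a^b dσ_c(t) / (t - u))` with `c` the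
base point of `[a, b]`, so `R_w(u) = 1 / u * exp (∫_a^b dσ(t) / (t - u))` with
`σ(x) = (w(x) - |x|) / 2` when `0 ∈ [a, b]`. When `0 ∉ [a, b]` the function `σ` is not constant between
`0` and `[a, b]`; any `c ∈ [a, b]` then gives the holomorphic function on the complement of `[a, b]`
which is `1 / u * exp (∑ p_k(w) u ^ (-k) / k)` for large `u`. As `σ_c` is Lipschitz,
`dσ_c(t) = σ_c'(t) dt`. -/
noncomputable def diagramR (a b : ℝ) (w : ℝ → ℝ) (u : ℂ) : ℂ :=
  1 / (u - (basePoint a b : ℂ)) *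
    Complex.exp (∫ t in Set.Icc a b, ((deriv (diagramSigma (basePoint a b) w) t : ℝ) : ℂ) / ((t : ℂ) - u))

/-- The diagrams in `Diagrams a b` with `R_w(u) > -1` for all real `u` off `[a, b]`. At real points
`R_w` is real valued, see `diagramR_ofReal_im`. -/
def RestrictedDiagrams (a b : ℝ) : Set (ℝ → ℝ) :=
  {w | w ∈ Diagrams a b ∧ ∀ u : ℝ, u ∉ Set.Icc a b → -1 < (diagramR a b w (u : ℂ)).re}

/-- The relation
`(1/z) (-1 + exp (z ∑_{k ≥ 0} ψ_k z ^ k)) = exp (∑_{k ≥ 1} p_k(w) z ^ k / k)`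
between moment generating functions: for all `z ≠ 0` in a neighbourhood of `0`, both series converge
and the two sides agree. -/
def MomentRelation (a b : ℝ) (ψ : Measure ℝ) (w : ℝ → ℝ) : Prop :=
  ∀ᶠ z : ℂ in 𝓝[≠] 0,
    Summable (fun k : ℕ => (measureMoment ψ k : ℂ) * z ^ k) ∧
    Summable (fun k : ℕ => (diagramMoment a b w (k + 1) : ℂ) / ((k : ℂ) + 1) * z ^ (k + 1)) ∧
    1 / z * (-1 + Complex.exp (z * ∑' k : ℕ, (measureMoment ψ k : ℂ) * z ^ k)) =
      Complex.exp (∑' k : ℕ, (diagramMoment a b w (k + 1) : ℂ) / ((k : ℂ) + 1) * z ^ (k + 1))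

theorem diagramR_ofReal_im (a b : ℝ) (w : ℝ → ℝ) (u : ℝ) : (diagramR a b w (u : ℂ)).im = 0 := by
  have h : diagramR a b w (u : ℂ) = ((1 / (u - basePoint a b) *
      Real.exp (∫ t in Set.Icc a b, deriv (diagramSigma (basePoint a b) w) t / (t - u)) : ℝ) : ℂ) := by
    unfold diagramR
    push_cast
    rw [← integral_complex_ofReal]
    push_cast
    rfl
  rw [h, Complex.ofReal_im]

/-- The second distributional derivative of `|x - x₀|` is twice the point mass at `x₀`. -/
theorem secondDerivPairing_abs (x₀ : ℝ) (φ : ℝ → ℝ) (hφ : ContDiff ℝ 2 φ)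
    (hc : HasCompactSupport φ) : secondDerivPairing (fun x => |x - x₀|) φ = 2 * φ x₀ := by
  have hd1 : ContDiff ℝ 1 (deriv φ) := hφ.deriv'
  have hd2 : Continuous (deriv (deriv φ)) := hd1.continuous_deriv le_rfl
  have hF : ContDiff ℝ 1 (fun x => (x - x₀) * deriv φ x - φ x) :=
    ((contDiff_id.sub contDiff_const).mul hd1).sub (hφ.of_le (by norm_num))
  have hFc : HasCompactSupport (fun x => (x - x₀) * deriv φ x - φ x) :=
    (hc.deriv.mul_left (f := fun x => x - x₀)).sub hc
  have hF' : deriv (fun x => (x - x₀) * deriv φ x - φ x) =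
      fun x => (x - x₀) * deriv (deriv φ) x := by
    funext x
    have e1 := (hφ.differentiable (by norm_num) x).hasDerivAt
    have e2 := (hd1.differentiable (by norm_num) x).hasDerivAt
    have := (((hasDerivAt_id x).sub_const x₀).mul e2).sub e1
    simp only [id] at this
    exact (this.congr_deriv (by ring)).deriv
  have hi := hFc.integral_Iic_deriv_eq hF x₀
  have hj := hFc.integral_Ioi_deriv_eq hF x₀
  simp only [hF', sub_self, zero_mul, zero_sub, neg_neg] at hi hj
  have hint : Integrable (fun x => |x - x₀| * deriv (deriv φ) x) :=
    (by fun_prop : Continuous (fun x => |x - x₀| * deriv (deriv φ) x)).integrable_of_hasCompactSupport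
      hc.deriv.deriv.mul_left
  unfold secondDerivPairing
  rw [← intervalIntegral.integral_Iic_add_Ioi hint.integrableOn hint.integrableOn (b := x₀)]
  have h1 : ∫ x in Set.Iic x₀, |x - x₀| * deriv (deriv φ) x =
      -∫ x in Set.Iic x₀, (x - x₀) * deriv (deriv φ) x := by
    rw [← integral_neg]
    refine setIntegral_congr_fun measurableSet_Iic fun x hx => ?_
    have hx' : x - x₀ ≤ 0 := sub_nonpos.2 hx
    simp only [abs_of_nonpos hx']
    ring
  have h2 : ∫ x in Set.Ioi x₀, |x - x₀| * deriv (deriv φ) x =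
      ∫ x in Set.Ioi x₀, (x - x₀) * deriv (deriv φ) x := by
    refine setIntegral_congr_fun measurableSet_Ioi fun x hx => ?_
    have hx' : 0 ≤ x - x₀ := sub_nonneg.2 (le_of_lt hx)
    simp only [abs_of_nonneg hx']
  rw [h1, h2, hi, hj]
  ring

/-- The value of `p_k(w)` does not depend on the cutoff of `t ^ k`. -/
theorem diagramMoment_eq {a b : ℝ} {w : ℝ → ℝ} (hw : w ∈ Diagrams a b) (k : ℕ) (φ : ℝ → ℝ)
    (hφ : ContDiff ℝ 2 φ) (hc : HasCompactSupport φ)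
    (h : ∀ᶠ x in 𝓝ˢ (Set.Icc a b), φ x = x ^ k) :
    diagramMoment a b w k = (1 / 2) * secondDerivPairing w φ := by
  obtain ⟨⟨hL, -⟩, x₀, hx₀, hoff⟩ := hw
  have hwc : Continuous w := by
    refine (LipschitzWith.of_dist_le_mul (K := 1) fun x y => ?_).continuous
    simpa [Real.dist_eq] using hL x y
  have split : ∀ g : ℝ → ℝ, ContDiff ℝ 2 g → HasCompactSupport g →
      secondDerivPairing w g = 2 * g x₀ + ∫ x, (w x - |x - x₀|) * deriv (deriv g) x := by
    intro g hg hgc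
    have hd2 : Continuous (deriv (deriv g)) :=
      (hg.deriv' : ContDiff ℝ 1 (deriv g)).continuous_deriv le_rfl
    rw [← secondDerivPairing_abs x₀ g hg hgc]
    unfold secondDerivPairing
    rw [← integral_add]
    · refine integral_congr_ae (Eventually.of_forall fun x => ?_)
      simp only
      ring
    · exact (by fun_prop : Continuous (fun x => |x - x₀| * deriv (deriv g) x)).integrable_of_hasCompactSupport
        hgc.deriv.deriv.mul_left
    · exact (by fun_prop : Continuous
        (fun x => (w x - |x - x₀|) * deriv (deriv g) x)).integrable_of_hasCompactSupport
        hgc.deriv.deriv.mul_left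
  have hcut : ∀ x ∈ Set.Icc a b,
      (fun t => intervalCutoff a b t * t ^ k) =ᶠ[𝓝 x] fun t => t ^ k := by
    intro x hx
    have hmem : x ∈ Metric.ball ((a + b) / 2) (intervalCutoff a b).rIn := by
      have hr : (intervalCutoff a b).rIn = |b - a| / 2 + 1 := rfl
      rw [Metric.mem_ball, Real.dist_eq, hr, abs_of_nonneg (a := b - a) (by linarith [hx.1, hx.2]), abs_lt]
      constructor <;> linarith [hx.1, hx.2]
    filter_upwards [(intervalCutoff a b).eventuallyEq_one_of_mem_ball hmem] with t ht
    simp [ht]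
  have hnear : ∀ x ∈ Set.Icc a b, (fun t => intervalCutoff a b t * t ^ k) =ᶠ[𝓝 x] φ :=
    fun x hx => (hcut x hx).trans (EventuallyEq.symm (eventually_nhdsSet_iff_forall.1 h x hx))
  unfold diagramMoment
  rw [split _ ((intervalCutoff a b).contDiff.mul (contDiff_fun_id.pow k))
    (intervalCutoff a b).hasCompactSupport.mul_right, split φ hφ hc, (hnear x₀ hx₀).eq_of_nhds]
  congr 2
  refine integral_congr_ae (Eventually.of_forall fun x => ?_)
  by_cases hx : x ∈ Set.Icc a b
  · simp only [(hnear x hx).deriv.deriv_eq]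
  · simp [hoff x hx]

/-!
Write `S_g(u) = ∫_a^b g(t) / (u - t) dt` for the Stieltjes transform of a density `g` on `[a, b]`.
Both `R`-functions are expressions in such transforms. If `ψ` has density `f`, then
`R_ψ = exp S_f - 1`; if `G = (1 - w') / 2` is the slope density of a diagram `w`, then
`R_w(u) = exp (S_G(u)) / (u - a)` (`diagramR_mul_sub`), and `w ↦ G` identifies diagrams on `[a, b]`
with densities with values in `[0, 1]` (`Diagrams.ext_of_slopeDensity`,
`exists_diagram_slopeDensity`). The correspondence therefore amounts to solving
`exp S_f - 1 = exp S_G / (u - a)` for `G`, respectively for `f`, among densities with values in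
`[0, 1]`.

A logarithm `L` of the relevant function is holomorphic off `[a, b]`, real on the rest of the real
axis and vanishes at infinity; its imaginary part is bounded on the upper half-plane, with boundary
values in `[-π, 0]` on `(a, b)`.
Any such `L` is an `S_g` with `0 ≤ g ≤ 1` (`exists_density_eq_stieltjes`): Poisson's formula in the
half-plane `Im u > ε` writes `Im L` as an integral of its values on the line `Im u = ε`, and a weak
limit in `L²` of `-Im L(t + iε) / π` as `ε → 0` is the required density. From measures to diagrams
(`exists_diagram`) the function is `L = log ((u - a) (exp S_f - 1))`. From diagrams to measures
(`exists_measure`) it is `L = log (1 + R_w)`; here `R_w > -1` on the real axis is what makes the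
logarithm holomorphic off `[a, b]`, and the total mass one is read off from `u R_w(u) → 1`.

Uniqueness on both sides holds because a density is determined by its Stieltjes transform near
infinity (`ae_eq_zero_of_stieltjes_eq_zero`): vanishing of the transform forces all moments to vanish.
Finally, with `u = 1 / z` the two sides of the moment relation are the expansions at infinity of
`u R_ψ(u)` and `u R_w(u)` (`momentRelation_iff_eventually`), and as the complement of `[a, b]` is
connected, equality near infinity is equality everywhere (`momentRelation_iff_eqOn`).
-/

/-! ### Stieltjes transforms of densities on an interval -/

/-- The complement of `[a, b]` in the complex plane. -/
def offInterval (a b : ℝ) : Set ℂ := ((fun t : ℝ => (t : ℂ)) '' Set.Icc a b)ᶜ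

/-- The Stieltjes transform `u ↦ ∫_a^b g(t) / (u - t) dt` of a density `g` on `[a, b]`. -/
noncomputable def stieltjes (a b : ℝ) (g : ℝ → ℝ) (u : ℂ) : ℂ :=
  ∫ t in Set.Icc a b, (g t : ℂ) / (u - t)

theorem isOpen_offInterval (a b : ℝ) : IsOpen (offInterval a b) :=
  (isCompact_Icc.image Complex.continuous_ofReal).isClosed.isOpen_compl

theorem mem_offInterval_of_im_ne_zero {a b : ℝ} {u : ℂ} (hu : u.im ≠ 0) :
    u ∈ offInterval a b := by
  rintro ⟨t, -, rfl⟩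
  simp at hu

theorem ofReal_mem_offInterval {a b x : ℝ} : (x : ℂ) ∈ offInterval a b ↔ x ∉ Set.Icc a b := by
  simp [offInterval]

theorem sub_ne_zero_of_mem_offInterval {a b : ℝ} {u : ℂ} (hu : u ∈ offInterval a b) {t : ℝ}
    (ht : t ∈ Set.Icc a b) : u - t ≠ 0 := fun h =>
  hu ⟨t, ht, (sub_eq_zero.1 h).symm⟩

theorem exists_ball_le_norm_sub {a b : ℝ} {u : ℂ} (hu : u ∈ offInterval a b) :
    ∃ δ > 0, ∀ v ∈ Metric.ball u δ, ∀ t ∈ Set.Icc a b, δ ≤ ‖v - (t : ℂ)‖ := by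
  obtain ⟨ε, hε, h⟩ := Metric.isOpen_iff.1 (isOpen_offInterval a b) u hu
  refine ⟨ε / 2, by positivity, fun v hv t ht => ?_⟩
  by_contra! hlt
  refine h (?_ : (t : ℂ) ∈ Metric.ball u ε) ⟨t, ht, rfl⟩
  rw [Metric.mem_ball] at hv ⊢
  rw [← dist_eq_norm] at hlt
  linarith [dist_triangle (t : ℂ) v u, dist_comm v (t : ℂ)]

theorem measurable_sub_ofReal (u : ℂ) : Measurable fun t : ℝ => u - (t : ℂ) := by fun_prop

theorem integrableOn_div_sub {a b : ℝ} {g : ℝ → ℝ} (hg : IntegrableOn g (Set.Icc a b)) {u : ℂ}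
    (hu : u ∈ offInterval a b) :
    IntegrableOn (fun t : ℝ => (g t : ℂ) / (u - t)) (Set.Icc a b) := by
  obtain ⟨δ, hδ, h⟩ := exists_ball_le_norm_sub hu
  have : IntegrableOn (fun t : ℝ => (u - (t : ℂ))⁻¹ * (g t : ℂ)) (Set.Icc a b) := by
    refine Integrable.bdd_mul (c := δ⁻¹) hg.ofReal
      (measurable_sub_ofReal u).inv.aestronglyMeasurable ?_
    filter_upwards [ae_restrict_mem measurableSet_Icc] with t ht
    rw [norm_inv]
    exact inv_anti₀ hδ (h u (Metric.mem_ball_self hδ) t ht)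
  refine this.congr_fun (fun t _ => ?_) measurableSet_Icc
  simp only [div_eq_mul_inv, mul_comm]

theorem differentiableOn_stieltjes {a b : ℝ} {g : ℝ → ℝ} (hg : IntegrableOn g (Set.Icc a b)) :
    DifferentiableOn ℂ (stieltjes a b g) (offInterval a b) := by
  intro u hu
  obtain ⟨δ, hδ, h⟩ := exists_ball_le_norm_sub hu
  have hb : Metric.ball u δ ⊆ offInterval a b := by
    rintro v hv ⟨t, ht, rfl⟩
    have := h _ hv t ht
    simp at this
    linarith
  have key := hasDerivAt_integral_of_dominated_loc_of_deriv_le (𝕜 := ℂ)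
    (μ := volume.restrict (Set.Icc a b)) (F := fun (v : ℂ) (t : ℝ) => (g t : ℂ) / (v - t))
    (F' := fun (v : ℂ) (t : ℝ) => -(g t : ℂ) / (v - t) ^ 2) (x₀ := u)
    (bound := fun t => |g t| * (δ ^ 2)⁻¹) (Metric.ball_mem_nhds u hδ)
    (Filter.eventually_of_mem (Metric.ball_mem_nhds u hδ) fun v hv =>
      (integrableOn_div_sub hg (hb hv)).aestronglyMeasurable)
    (integrableOn_div_sub hg hu) ?_ ?_ ?_ ?_
  · exact key.2.differentiableAt.differentiableWithinAt
  · refine (hg.ofReal.aestronglyMeasurable.neg.mul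
      ((measurable_sub_ofReal u).pow_const 2).inv.aestronglyMeasurable).congr ?_
    exact Eventually.of_forall fun t => by simp [div_eq_mul_inv]
  · filter_upwards [ae_restrict_mem measurableSet_Icc] with t ht v hv
    rw [norm_div, norm_neg, norm_pow, div_eq_mul_inv, Complex.norm_real, Real.norm_eq_abs]
    have := h v hv t ht
    gcongr
  · exact hg.abs.mul_const _
  · filter_upwards [ae_restrict_mem measurableSet_Icc] with t ht v hv
    have hne := sub_ne_zero_of_mem_offInterval (hb hv) ht
    have := (hasDerivAt_const v (g t : ℂ)).div ((hasDerivAt_id v).sub_const (t : ℂ)) hne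
    simp only [id_eq, zero_mul, mul_one, zero_sub] at this
    exact this

theorem stieltjes_conj (a b : ℝ) (g : ℝ → ℝ) (u : ℂ) :
    stieltjes a b g (starRingEnd ℂ u) = starRingEnd ℂ (stieltjes a b g u) := by
  unfold stieltjes
  rw [← integral_conj]
  simp

theorem stieltjes_ofReal (a b : ℝ) (g : ℝ → ℝ) (x : ℝ) :
    stieltjes a b g x = ((∫ t in Set.Icc a b, g t / (x - t) : ℝ) : ℂ) := by
  unfold stieltjes
  rw [← integral_complex_ofReal]
  push_cast
  rfl

/-- `u ∫ g(t) / (u - t) dt = ∫ g + ∫ t g(t) / (u - t) dt`. -/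
theorem mul_stieltjes {a b : ℝ} {g : ℝ → ℝ} (hg : IntegrableOn g (Set.Icc a b)) {u : ℂ}
    (hu : u ∈ offInterval a b) :
    u * stieltjes a b g u =
      ((∫ t in Set.Icc a b, g t : ℝ) : ℂ) + stieltjes a b (fun t => t * g t) u := by
  have hg' : IntegrableOn (fun t => t * g t) (Set.Icc a b) :=
    hg.continuousOn_mul continuousOn_id isCompact_Icc
  have hadd := integral_add hg.ofReal (integrableOn_div_sub hg' hu)
  unfold stieltjes
  rw [← integral_complex_ofReal, ← integral_const_mul]
  refine Eq.trans ?_ hadd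
  refine setIntegral_congr_fun measurableSet_Icc fun t ht => ?_
  have := sub_ne_zero_of_mem_offInterval hu ht
  simp only [Complex.coe_algebraMap, Complex.ofReal_mul]
  field_simp
  ring

theorem eventually_mem_offInterval (a b : ℝ) :
    ∀ᶠ u in Bornology.cobounded ℂ, u ∈ offInterval a b :=
  (isCompact_Icc.image Complex.continuous_ofReal).isBounded

theorem tendsto_stieltjes_cobounded {a b : ℝ} {g : ℝ → ℝ} (hg : IntegrableOn g (Set.Icc a b)) :
    Tendsto (stieltjes a b g) (Bornology.cobounded ℂ) (𝓝 0) := by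
  set M := max |a| |b|
  have hM : ∀ t ∈ Set.Icc a b, |t| ≤ M := fun t ht => abs_le_max_abs_abs ht.1 ht.2
  have hlim : Tendsto (fun u : ℂ => (∫ t in Set.Icc a b, |g t|) * (‖u‖ - M)⁻¹)
      (Bornology.cobounded ℂ) (𝓝 0) := by
    rw [← mul_zero (∫ t in Set.Icc a b, |g t|)]
    refine Tendsto.const_mul _ (tendsto_inv_atTop_zero.comp ?_)
    exact tendsto_atTop_add_const_right _ (-M) tendsto_norm_cobounded_atTop
  refine squeeze_zero_norm' ?_ hlim
  filter_upwards [tendsto_norm_cobounded_atTop.eventually_gt_atTop M] with u hu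
  unfold stieltjes
  rw [← integral_mul_const]
  refine norm_integral_le_of_norm_le (hg.abs.mul_const _) ?_
  filter_upwards [ae_restrict_mem measurableSet_Icc] with t ht
  rw [norm_div, Complex.norm_real, Real.norm_eq_abs, div_eq_mul_inv]
  have := norm_sub_norm_le u (t : ℂ)
  rw [Complex.norm_real, Real.norm_eq_abs] at this
  gcongr
  linarith [hM t ht]

theorem tendsto_mul_stieltjes_cobounded {a b : ℝ} {g : ℝ → ℝ}
    (hg : IntegrableOn g (Set.Icc a b)) :
    Tendsto (fun u => u * stieltjes a b g u) (Bornology.cobounded ℂ)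
      (𝓝 ((∫ t in Set.Icc a b, g t : ℝ) : ℂ)) := by
  have hg' : IntegrableOn (fun t => t * g t) (Set.Icc a b) :=
    hg.continuousOn_mul continuousOn_id isCompact_Icc
  have := (tendsto_stieltjes_cobounded hg').const_add ((∫ t in Set.Icc a b, g t : ℝ) : ℂ)
  rw [add_zero] at this
  refine this.congr' ?_
  filter_upwards [eventually_mem_offInterval a b] with u hu
  rw [mul_stieltjes hg hu]

theorem stieltjes_im {a b : ℝ} {g : ℝ → ℝ} (hg : IntegrableOn g (Set.Icc a b)) {u : ℂ}
    (hu : u ∈ offInterval a b) :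
    (stieltjes a b g u).im = -∫ t in Set.Icc a b, g t * (u.im / Complex.normSq (u - t)) := by
  unfold stieltjes
  have := integral_im (𝕜 := ℂ) (integrableOn_div_sub hg hu)
  simp only [RCLike.im_eq_complex_im] at this
  rw [← this, ← integral_neg]
  congr 1 with t
  simp [Complex.div_im]
  ring

theorem integrableOn_im_kernel {a b : ℝ} {g : ℝ → ℝ} (hg : IntegrableOn g (Set.Icc a b)) {u : ℂ}
    (hu : u ∈ offInterval a b) :
    IntegrableOn (fun t => g t * (u.im / Complex.normSq (u - t))) (Set.Icc a b) := by
  have := (integrableOn_div_sub hg hu).im.neg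
  refine this.congr (Eventually.of_forall fun t => ?_)
  simp [Complex.div_im]
  ring

theorem stieltjes_im_mono {a b : ℝ} {f g : ℝ → ℝ} (hf : IntegrableOn f (Set.Icc a b))
    (hg : IntegrableOn g (Set.Icc a b)) (hfg : ∀ t ∈ Set.Icc a b, f t ≤ g t) {u : ℂ}
    (hu : 0 < u.im) : (stieltjes a b g u).im ≤ (stieltjes a b f u).im := by
  have ho : u ∈ offInterval a b := mem_offInterval_of_im_ne_zero hu.ne'
  rw [stieltjes_im hf ho, stieltjes_im hg ho, neg_le_neg_iff]
  refine setIntegral_mono_on (integrableOn_im_kernel hf ho) (integrableOn_im_kernel hg ho)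
    measurableSet_Icc fun t ht => ?_
  have := Complex.normSq_nonneg (u - t)
  gcongr
  exact hfg t ht

/-- The exponential of the transform of the density `1` on `[c, d]` is `(u - c) / (u - d)`, with no
choice of a branch of the logarithm. The interval `[a, b]` only serves to locate `u`. -/
theorem exp_stieltjes_one {a b c d : ℝ} (hcd : c ≤ d) (hsub : Set.Icc c d ⊆ Set.Icc a b) {u : ℂ}
    (hu : u ∈ offInterval a b) :
    (u - d) * Complex.exp (stieltjes c d (fun _ => 1) u) = u - c := by
  have hne : ∀ t ∈ Set.Icc c d, u - (t : ℂ) ≠ 0 := fun t ht =>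
    sub_ne_zero_of_mem_offInterval hu (hsub ht)
  have hcont : ∀ t ∈ Set.Icc c d, ContinuousAt (fun t : ℝ => 1 / (u - (t : ℂ))) t := fun t ht =>
    continuousAt_const.div (by fun_prop) (hne t ht)
  set J : ℝ → ℂ := fun x => ∫ t in c..x, 1 / (u - (t : ℂ))
  have hJ : ∀ x ∈ Set.Icc c d, HasDerivAt J (1 / (u - (x : ℂ))) x := fun x hx =>
    intervalIntegral.integral_hasDerivAt_right
      (ContinuousOn.intervalIntegrable fun t ht => (hcont t (Set.Icc_subset_Icc_right hx.2
        (Set.uIcc_of_le hx.1 ▸ ht))).continuousWithinAt)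
      ((measurable_sub_ofReal u).const_div 1).stronglyMeasurable.stronglyMeasurableAtFilter
      (hcont x hx)
  -- the derivative of `x ↦ (u - x) exp (∫_c^x dt / (u - t))` vanishes
  have hF : ∀ x ∈ Set.Icc c d,
      HasDerivAt (fun x : ℝ => (u - (x : ℂ)) * Complex.exp (J x)) 0 x := by
    intro x hx
    have h1 : HasDerivAt (fun x : ℝ => u - (x : ℂ)) (-1) x := by
      simpa using (Complex.ofRealCLM.hasDerivAt (x := x)).const_sub u
    refine (h1.mul (hJ x hx).cexp).congr_deriv ?_
    have := hne x hx
    field_simp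
    ring
  have hconst := constant_of_has_deriv_right_zero
    (fun x hx => (hF x hx).continuousAt.continuousWithinAt)
    (fun x hx => (hF x (Set.Ico_subset_Icc_self hx)).hasDerivWithinAt) d (Set.right_mem_Icc.2 hcd)
  have hJd : stieltjes c d (fun _ => 1) u = J d := by
    simp only [stieltjes, J, Complex.ofReal_one]
    rw [intervalIntegral.integral_of_le hcd, integral_Icc_eq_integral_Ioc]
  rw [hJd]
  simpa [J] using hconst

/-- On the upper half-plane the imaginary part of the transform of the density `1` is the angle under
which `[a, b]` is seen, up to sign. -/
theorem stieltjes_one_im {a b : ℝ} (hab : a ≤ b) {u : ℂ} (hu : 0 < u.im) :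
    (stieltjes a b (fun _ => 1) u).im = Complex.arg (u - a) - Complex.arg (u - b) := by
  have hlog : ∀ x : ℝ, HasDerivAt (fun x : ℝ => -Complex.log (u - x)) (1 / (u - (x : ℂ))) x := by
    intro x
    have h1 : HasDerivAt (fun x : ℝ => u - (x : ℂ)) (-1) x := by
      simpa using (Complex.ofRealCLM.hasDerivAt (x := x)).const_sub u
    have h2 : u - (x : ℂ) ∈ Complex.slitPlane := Or.inr (by simp [hu.ne'])
    exact (h1.clog_real h2).neg.congr_deriv (by ring)
  have hne : ∀ x : ℝ, u - (x : ℂ) ≠ 0 := fun x h => by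
    have := congrArg Complex.im h
    simp [hu.ne'] at this
  have := intervalIntegral.integral_eq_sub_of_hasDerivAt (a := a) (b := b) (fun x _ => hlog x)
    (Continuous.intervalIntegrable (by
      exact continuous_const.div (by fun_prop) hne) _ _)
  have hS : stieltjes a b (fun _ => 1) u = ∫ x in a..b, 1 / (u - (x : ℂ)) := by
    simp only [stieltjes, Complex.ofReal_one]
    rw [intervalIntegral.integral_of_le hab, integral_Icc_eq_integral_Ioc]
  rw [hS, this]
  simp [Complex.log_im]
  ring

theorem arg_mem_Ioo_of_im_pos {z : ℂ} (hz : 0 < z.im) : Complex.arg z ∈ Set.Ioo 0 Real.pi := by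
  refine ⟨lt_of_le_of_ne (Complex.arg_nonneg_iff.2 hz.le) fun h => ?_,
    lt_of_le_of_ne (Complex.arg_le_pi z) fun h => ?_⟩
  · exact hz.ne' (Complex.arg_eq_zero_iff.1 h.symm).2
  · exact hz.ne' (Complex.arg_eq_pi_iff.1 h).2

/-- On the upper half-plane the imaginary part of the transform of a density with values in `[0, 1]`
lies between those of the transforms of `1` and `0`. -/
theorem stieltjes_im_mem {a b : ℝ} (hab : a ≤ b) {g : ℝ → ℝ} (hg : IntegrableOn g (Set.Icc a b))
    (h0 : ∀ t, 0 ≤ g t ∧ g t ≤ 1) {u : ℂ} (hu : 0 < u.im) :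
    Complex.arg (u - a) - Complex.arg (u - b) ≤ (stieltjes a b g u).im ∧
      (stieltjes a b g u).im ≤ 0 := by
  constructor
  · rw [← stieltjes_one_im hab hu]
    exact stieltjes_im_mono hg (integrableOn_const (by simp)) (fun t _ => (h0 t).2) hu
  · have := stieltjes_im_mono (f := fun _ => 0) (integrableOn_const (by simp)) hg
      (fun t _ => (h0 t).1) hu
    simpa [stieltjes] using this

/-! ### Poisson's formula on the upper half-plane -/

theorem normSq_ofReal_sub (u : ℂ) (t : ℝ) :
    Complex.normSq (u - t) = (t - u.re) ^ 2 + u.im ^ 2 := by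
  simp [Complex.normSq_apply]
  ring

theorem integrable_inv_normSq_sub {u : ℂ} (hu : 0 < u.im) :
    Integrable fun t : ℝ => (Complex.normSq (u - t))⁻¹ := by
  have h := ((integrable_inv_one_add_sq.comp_div hu.ne').comp_sub_right u.re).const_mul
    ((u.im ^ 2)⁻¹)
  refine h.congr (Eventually.of_forall fun t => ?_)
  simp only [normSq_ofReal_sub]
  rw [← mul_inv]
  congr 1
  field_simp
  ring

theorem integral_inv_normSq_sub {u : ℂ} (hu : 0 < u.im) :
    ∫ t : ℝ, (Complex.normSq (u - t))⁻¹ = Real.pi / u.im := by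
  have h1 : ∀ t : ℝ, (Complex.normSq (u - t))⁻¹ =
      (u.im ^ 2)⁻¹ * (1 + ((t - u.re) / u.im) ^ 2)⁻¹ := fun t => by
    rw [normSq_ofReal_sub, ← mul_inv]
    congr 1
    field_simp
    ring
  simp only [h1]
  rw [integral_const_mul, integral_sub_right_eq_self (fun t => (1 + (t / u.im) ^ 2)⁻¹) u.re,
    Measure.integral_comp_div (fun t : ℝ => (1 + t ^ 2)⁻¹) u.im, integral_univ_inv_one_add_sq,
    abs_of_pos hu, smul_eq_mul]
  field_simp

/-- Poisson's formula on the upper half-plane for bounded holomorphic functions that extend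
holomorphically across the real axis. -/
theorem poisson_upperHalfPlane {h : ℂ → ℂ} {δ C : ℝ} (hδ : 0 < δ)
    (hd : DifferentiableOn ℂ h {z | -δ < z.im}) (hC : ∀ z : ℂ, 0 ≤ z.im → ‖h z‖ ≤ C) {u : ℂ}
    (hu : 0 < u.im) :
    h u * (Real.pi / u.im) = ∫ t : ℝ, h t * ((Complex.normSq (u - t))⁻¹ : ℝ) := by
  have hC0 : 0 ≤ C := (norm_nonneg _).trans (hC u hu.le)
  have hU : IsOpen {z : ℂ | -δ < z.im} := isOpen_lt continuous_const Complex.continuous_im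
  have huU : {z : ℂ | -δ < z.im} ∈ 𝓝 u := hU.mem_nhds (by simp only [Set.mem_ofPred_eq]; linarith)
  -- `Q z = (h z - h u) / ((z - u) (z - ū))` is holomorphic and `O(|z| ^ (-2))`
  set Q : ℂ → ℂ := fun z => dslope h u z / (z - starRingEnd ℂ u) with hQ
  have hQd : DifferentiableOn ℂ Q {z | -(min δ u.im) < z.im} := by
    refine (((Complex.differentiableOn_dslope huU).2 hd).mono fun z hz => ?_).div
      (by fun_prop) fun z hz => ?_
    · have := min_le_left δ u.im
      simp only [Set.mem_ofPred_eq] at hz ⊢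
      linarith
    · intro h0
      have h1 := congrArg Complex.im h0
      have := min_le_right δ u.im
      simp only [Set.mem_ofPred_eq, Complex.sub_im, Complex.conj_im, Complex.zero_im] at hz h1
      linarith
  have hQb : ∀ z : ℂ, 0 ≤ z.im → ‖u‖ < ‖z‖ → ‖Q z‖ ≤ 2 * C / (‖z‖ - ‖u‖) ^ 2 := by
    intro z hz hzu
    have hne : z ≠ u := fun e => by simp [e] at hzu
    rw [hQ]
    simp only
    rw [dslope_of_ne _ hne, slope_def_field, div_div, norm_div, norm_mul]
    have h1 : ‖h z - h u‖ ≤ 2 * C := by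
      linarith [norm_sub_le (h z) (h u), hC z hz, hC u hu.le]
    have h2 := norm_sub_norm_le z u
    have h3 := norm_sub_norm_le z (starRingEnd ℂ u)
    rw [Complex.norm_conj] at h3
    have h4 : 0 < ‖z‖ - ‖u‖ := sub_pos.2 hzu
    rw [sq]
    gcongr
  have hQt : ∀ t : ℝ, Q t = h t * ((Complex.normSq (u - t))⁻¹ : ℝ)
      - h u * ((Complex.normSq (u - t))⁻¹ : ℝ) := by
    intro t
    have hne : (t : ℂ) ≠ u := fun e => by simp [← e] at hu
    have hns : ((Complex.normSq (u - t) : ℝ) : ℂ) = (t - u) * (t - starRingEnd ℂ u) := by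
      rw [Complex.normSq_eq_conj_mul_self]
      simp
      ring
    rw [hQ]
    simp only
    rw [dslope_of_ne _ hne, slope_def_field, Complex.ofReal_inv, hns]
    field_simp
  have hmeas : AEStronglyMeasurable (fun t : ℝ => h t) := by
    refine Continuous.aestronglyMeasurable ?_
    exact hd.continuousOn.comp_continuous Complex.continuous_ofReal (by simp [hδ])
  have hint1 : Integrable fun t : ℝ => h t * ((Complex.normSq (u - t))⁻¹ : ℝ) :=
    (integrable_inv_normSq_sub hu).ofReal.bdd_mul (c := C) hmeas
      (Eventually.of_forall fun t => hC t (by simp))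
  have hint2 : Integrable fun t : ℝ => h u * ((Complex.normSq (u - t))⁻¹ : ℝ) :=
    (integrable_inv_normSq_sub hu).ofReal.const_mul _
  have hintQ : Integrable fun t : ℝ => Q t :=
    (hint1.sub hint2).congr (Eventually.of_forall fun t => (hQt t).symm)
  -- integrate `Q` over the boundary of `[-M, M] × [0, M]`; the other three sides are `O(1 / M)`
  have hlim : Tendsto (fun M : ℝ => ∫ t in -M..M, Q t) atTop (𝓝 (∫ t : ℝ, Q t)) :=
    intervalIntegral_tendsto_integral hintQ tendsto_neg_atTop_atBot tendsto_id
  have hzero : Tendsto (fun M : ℝ => ∫ t in -M..M, Q t) atTop (𝓝 0) := by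
    have hb : ∀ᶠ M : ℝ in atTop, ‖∫ t in -M..M, Q t‖ ≤ 4 * (2 * C) * (M / (M - ‖u‖) ^ 2) := by
      filter_upwards [eventually_gt_atTop ‖u‖] with M hM
      have hM0 : 0 < M := (norm_nonneg u).trans_lt hM
      have hrect := Complex.integral_boundary_rect_eq_zero_of_differentiableOn Q (-M : ℂ)
        (M + M * Complex.I) (hQd.mono fun z hz => by
          have := hz.2
          simp [Set.uIcc_of_le hM0.le] at this
          have h0 : 0 < min δ u.im := lt_min hδ hu
          simp only [Set.mem_ofPred_eq]
          linarith)
      simp at hrect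
      have hside : ∀ z : ℂ, 0 ≤ z.im → M ≤ ‖z‖ → ‖Q z‖ ≤ 2 * C / (M - ‖u‖) ^ 2 := by
        intro z hz hMz
        refine (hQb z hz (hM.trans_le hMz)).trans ?_
        have := sub_pos.2 hM
        gcongr
      have e1 : ‖∫ x in -M..M, Q (x + M * Complex.I)‖ ≤ 2 * C / (M - ‖u‖) ^ 2 * |M - -M| :=
        intervalIntegral.norm_integral_le_of_norm_le_const fun x _ => hside _ (by simp [hM0.le])
          (by simpa [abs_of_pos hM0] using Complex.abs_im_le_norm (x + M * Complex.I))
      have e2 : ‖∫ y in 0..M, Q (M + y * Complex.I)‖ ≤ 2 * C / (M - ‖u‖) ^ 2 * |M - 0| := by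
        refine intervalIntegral.norm_integral_le_of_norm_le_const fun y hy => hside _ ?_
          (by simpa [abs_of_pos hM0] using Complex.abs_re_le_norm (M + y * Complex.I))
        rw [Set.uIoc_of_le hM0.le] at hy
        simpa using hy.1.le
      have e3 : ‖∫ y in 0..M, Q (-M + y * Complex.I)‖ ≤ 2 * C / (M - ‖u‖) ^ 2 * |M - 0| := by
        refine intervalIntegral.norm_integral_le_of_norm_le_const fun y hy => hside _ ?_
          (by simpa [abs_of_pos hM0] using Complex.abs_re_le_norm (-M + y * Complex.I))
        rw [Set.uIoc_of_le hM0.le] at hy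
        simpa using hy.1.le
      have heq : ∫ t in -M..M, Q t = (∫ x in -M..M, Q (x + M * Complex.I))
          - Complex.I * (∫ y in 0..M, Q (M + y * Complex.I))
          + Complex.I * (∫ y in 0..M, Q (-M + y * Complex.I)) := by
        linear_combination hrect
      rw [heq]
      refine (norm_add_le _ _).trans ((add_le_add_left (norm_sub_le _ _) _).trans ?_)
      rw [norm_mul, norm_mul, Complex.norm_I, one_mul, one_mul]
      rw [abs_of_pos (by linarith)] at e1 e2 e3
      refine (add_le_add (add_le_add e1 e2) e3).trans (le_of_eq ?_)
      ring
    refine squeeze_zero_norm' hb ?_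
    rw [← mul_zero (4 * (2 * C))]
    refine Tendsto.const_mul _ ?_
    have h1 : Tendsto (fun M : ℝ => M - ‖u‖) atTop atTop :=
      tendsto_atTop_add_const_right _ (-‖u‖) tendsto_id
    have h2 : Tendsto (fun x : ℝ => x⁻¹ + ‖u‖ * (x⁻¹) ^ 2) atTop (𝓝 0) := by
      simpa using tendsto_inv_atTop_zero.add ((tendsto_inv_atTop_zero (𝕜 := ℝ)).pow 2 |>.const_mul ‖u‖)
    refine (h2.comp h1).congr' ?_
    filter_upwards [eventually_gt_atTop ‖u‖] with M hM
    have := sub_pos.2 hM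
    simp only [Function.comp]
    field_simp
    ring
  have h0 := tendsto_nhds_unique hlim hzero
  simp only [hQt] at h0
  rw [integral_sub hint1 hint2, integral_const_mul, integral_complex_ofReal,
    integral_inv_normSq_sub hu, sub_eq_zero] at h0
  rw [h0]
  push_cast
  rfl

/-! ### Weak compactness of densities -/

/-- Weak compactness of the set of densities with values in `[0, 1]`, from the Banach–Alaoglu theorem in
`L²`. The limit is taken along an ultrafilter, which avoids extracting a subsequence. -/
theorem exists_weak_limit {μ : Measure ℝ} [IsFiniteMeasure μ] (g : ℕ → ℝ → ℝ)
    (hg : ∀ n, Measurable (g n)) (h01 : ∀ n x, 0 ≤ g n x ∧ g n x ≤ 1) :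
    ∃ f : ℝ → ℝ, Measurable f ∧ (∀ x, 0 ≤ f x ∧ f x ≤ 1) ∧ ∃ 𝒰 : Filter ℕ, 𝒰.NeBot ∧ 𝒰 ≤ atTop ∧
      ∀ k : ℝ → ℝ, MemLp k 2 μ →
        Tendsto (fun n => ∫ t, g n t * k t ∂μ) 𝒰 (𝓝 (∫ t, f t * k t ∂μ)) := by
  have hmem : ∀ n, MemLp (g n) 2 μ := fun n =>
    MemLp.of_bound (hg n).aestronglyMeasurable 1 (Eventually.of_forall fun x => by
      rw [Real.norm_eq_abs, abs_of_nonneg (h01 n x).1]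
      exact (h01 n x).2)
  set G : ℕ → Lp ℝ 2 μ := fun n => (hmem n).toLp
  set D : ℕ → WeakDual ℝ (Lp ℝ 2 μ) := fun n =>
    WeakDual.toStrongDual.symm (InnerProductSpace.toDual ℝ _ (G n))
  obtain ⟨R, hR⟩ : ∃ R, ∀ n, ‖G n‖ ≤ R := by
    refine ⟨_, fun n => Lp.norm_le_of_ae_bound (C := 1) zero_le_one ?_⟩
    filter_upwards [(hmem n).coeFn_toLp] with x hx
    rw [hx, Real.norm_eq_abs, abs_of_nonneg (h01 n x).1]
    exact (h01 n x).2
  have hD : ∀ n, D n ∈ WeakDual.toStrongDual ⁻¹'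
      Metric.closedBall (0 : StrongDual ℝ (Lp ℝ 2 μ)) R := by
    intro n
    simp [D, hR]
  set 𝒰 : Ultrafilter ℕ := Ultrafilter.of atTop
  obtain ⟨φ, -, hφ⟩ := isCompact_iff_ultrafilter_le_nhds.1
    (WeakDual.isCompact_closedBall (0 : StrongDual ℝ (Lp ℝ 2 μ)) R) (𝒰.map D)
    (tendsto_principal.2 (Eventually.of_forall hD))
  set F : Lp ℝ 2 μ := (InnerProductSpace.toDual ℝ _).symm (WeakDual.toStrongDual φ) with hF
  have hFmeas : Measurable F := (Lp.stronglyMeasurable F).measurable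
  have hFint : Integrable F μ := (Lp.memLp F).integrable (by norm_num)
  have hlim : ∀ k : ℝ → ℝ, MemLp k 2 μ →
      Tendsto (fun n => ∫ t, g n t * k t ∂μ) 𝒰 (𝓝 (∫ t, F t * k t ∂μ)) := by
    intro k hk
    have h1 : Tendsto (fun n => D n hk.toLp) 𝒰 (𝓝 (φ hk.toLp)) :=
      ((WeakDual.eval_continuous hk.toLp).tendsto φ).comp hφ
    have h2 : ∀ n, D n hk.toLp = ∫ t, g n t * k t ∂μ := by
      intro n
      change inner ℝ (G n) hk.toLp = _
      rw [L2.inner_def]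
      refine integral_congr_ae ?_
      filter_upwards [(hmem n).coeFn_toLp, hk.coeFn_toLp] with x hx hx'
      simp only [G, hx, hx']
      simp [mul_comm]
    have h3 : φ hk.toLp = ∫ t, F t * k t ∂μ := by
      have : φ hk.toLp = inner ℝ F hk.toLp := by
        rw [hF, InnerProductSpace.toDual_symm_apply]
        rfl
      rw [this, L2.inner_def]
      refine integral_congr_ae ?_
      filter_upwards [hk.coeFn_toLp] with x hx'
      rw [hx']
      simp [mul_comm]
    simpa only [h2, h3] using h1
  have hset : ∀ s, MeasurableSet s →
      Tendsto (fun n => ∫ t in s, g n t ∂μ) 𝒰 (𝓝 (∫ t in s, F t ∂μ)) := by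
    intro s hs
    have := hlim (s.indicator 1) ((memLp_const (1 : ℝ)).indicator hs)
    have h1 : ∀ h : ℝ → ℝ, ∫ t, h t * s.indicator 1 t ∂μ = ∫ t in s, h t ∂μ := by
      intro h
      rw [← integral_indicator hs]
      congr 1 with t
      by_cases ht : t ∈ s <;> simp [ht]
    simpa only [h1] using this
  have hgint : ∀ n, Integrable (g n) μ := fun n => (hmem n).integrable (by norm_num)
  have hF0 : 0 ≤ᵐ[μ] F := ae_nonneg_of_forall_setIntegral_nonneg hFint fun s hs _ =>
    ge_of_tendsto' (hset s hs) fun n => integral_nonneg fun t => (h01 n t).1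
  have hF1 : 0 ≤ᵐ[μ] fun t => 1 - F t :=
    ae_nonneg_of_forall_setIntegral_nonneg ((integrable_const 1).sub hFint) fun s hs _ => by
      rw [integral_sub (integrable_const 1) hFint.integrableOn, sub_nonneg]
      exact le_of_tendsto' (hset s hs) fun n =>
        integral_mono (hgint n).integrableOn (integrable_const 1) fun t => (h01 n t).2
  refine ⟨fun t => max 0 (min 1 (F t)), by fun_prop, fun t => ⟨le_max_left _ _, by simp⟩, 𝒰,
    inferInstance, Ultrafilter.of_le _, fun k hk => ?_⟩
  convert hlim k hk using 2
  refine integral_congr_ae ?_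
  filter_upwards [hF0, hF1] with t h0 h1
  simp only [Pi.zero_apply, sub_nonneg] at h0 h1
  simp [h0, h1]

/-! ### The identity theorem off the interval -/

theorem isPreconnected_offInterval (a b : ℝ) : IsPreconnected (offInterval a b) := by
  have hstar : IsPreconnected Complex.slitPlane :=
    (Complex.starConvex_one_slitPlane.isPathConnected (by simp)).isConnected.isPreconnected
  have h1 : IsPreconnected ((fun z : ℂ => z + b) '' Complex.slitPlane) :=
    hstar.image _ (by fun_prop)
  have h2 : IsPreconnected ((fun z : ℂ => a - z) '' Complex.slitPlane) :=
    hstar.image _ (by fun_prop)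
  -- the complement of `[a, b]` is the union of two overlapping slit planes
  have hEq : offInterval a b =
      ((fun z : ℂ => z + b) '' Complex.slitPlane) ∪ ((fun z : ℂ => a - z) '' Complex.slitPlane) := by
    ext u
    have e1 : u ∈ (fun z : ℂ => z + b) '' Complex.slitPlane ↔ b < u.re ∨ u.im ≠ 0 := by
      constructor
      · rintro ⟨z, hz, rfl⟩
        simpa [Complex.mem_slitPlane_iff] using hz
      · intro h
        exact ⟨u - b, by simpa [Complex.mem_slitPlane_iff] using h, by simp⟩
    have e2 : u ∈ (fun z : ℂ => a - z) '' Complex.slitPlane ↔ u.re < a ∨ u.im ≠ 0 := by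
      constructor
      · rintro ⟨z, hz, rfl⟩
        simpa [Complex.mem_slitPlane_iff] using hz
      · intro h
        exact ⟨a - u, by simpa [Complex.mem_slitPlane_iff] using h, by simp⟩
    rw [Set.mem_union, e1, e2]
    by_cases hu : u.im = 0
    · obtain ⟨x, rfl⟩ : ∃ x : ℝ, u = x := ⟨u.re, Complex.ext rfl (by simp [hu])⟩
      simp only [ofReal_mem_offInterval, Set.mem_Icc, Complex.ofReal_re, Complex.ofReal_im]
      grind
    · simp [hu, mem_offInterval_of_im_ne_zero hu]
  rw [hEq]
  refine h1.union (b + Complex.I) ?_ ?_ h2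
  · exact ⟨Complex.I, by simp [Complex.mem_slitPlane_iff], by ring⟩
  · exact ⟨a - b - Complex.I, by simp [Complex.mem_slitPlane_iff], by ring⟩

theorem isOpen_upperHalfPlane : IsOpen {z : ℂ | 0 < z.im} :=
  isOpen_lt continuous_const Complex.continuous_im

theorem eqOn_offInterval_of_eventuallyEq {a b : ℝ} {F G : ℂ → ℂ}
    (hF : DifferentiableOn ℂ F (offInterval a b)) (hG : DifferentiableOn ℂ G (offInterval a b))
    {z : ℂ} (hz : z ∈ offInterval a b) (h : F =ᶠ[𝓝 z] G) : Set.EqOn F G (offInterval a b) :=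
  (hF.analyticOnNhd (isOpen_offInterval a b)).eqOn_of_preconnected_of_eventuallyEq
    (hG.analyticOnNhd (isOpen_offInterval a b)) (isPreconnected_offInterval a b) hz h

/-! ### Representation by Stieltjes transforms -/

/-- The boundedness needed to apply Poisson's formula on the half-plane `Im z ≥ ε`. -/
theorem exists_norm_le_of_le_im {a b : ℝ} {L : ℂ → ℂ}
    (hd : DifferentiableOn ℂ L (offInterval a b))
    (hlim : Tendsto L (Bornology.cobounded ℂ) (𝓝 0)) {ε : ℝ} (hε : 0 < ε) :
    ∃ C, ∀ z : ℂ, ε ≤ z.im → ‖L z‖ ≤ C := by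
  have h1 : ∀ᶠ z in Bornology.cobounded ℂ, ‖L z‖ < 1 :=
    (tendsto_zero_iff_norm_tendsto_zero.1 hlim).eventually_lt_const one_pos
  obtain ⟨R, -, hR⟩ := (Filter.hasBasis_cobounded_norm (E := ℂ)).eventually_iff.1 h1
  have hK : IsCompact (Metric.closedBall (0 : ℂ) R ∩ {z | ε ≤ z.im}) :=
    (isCompact_closedBall 0 R).inter_right (isClosed_le continuous_const Complex.continuous_im)
  obtain ⟨C, hC⟩ := hK.exists_bound_of_continuousOn (f := L)
    (hd.continuousOn.mono fun z hz => mem_offInterval_of_im_ne_zero (hε.trans_le hz.2).ne')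
  refine ⟨max C 1, fun z hz => ?_⟩
  by_cases hzR : ‖z‖ ≤ R
  · exact (hC z ⟨by simpa using hzR, hz⟩).trans (le_max_left _ _)
  · exact (hR (not_le.1 hzR).le).le.trans (le_max_right _ _)

theorem eqOn_upperHalfPlane_of_im_eq {a b : ℝ} {F G : ℂ → ℂ}
    (hF : DifferentiableOn ℂ F (offInterval a b)) (hG : DifferentiableOn ℂ G (offInterval a b))
    (hF0 : Tendsto F (Bornology.cobounded ℂ) (𝓝 0)) (hG0 : Tendsto G (Bornology.cobounded ℂ) (𝓝 0))
    (him : ∀ z : ℂ, 0 < z.im → (F z).im = (G z).im) {z : ℂ} (hz : 0 < z.im) : F z = G z := by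
  have hsub : {z : ℂ | 0 < z.im} ⊆ offInterval a b := fun z hz =>
    mem_offInterval_of_im_ne_zero (ne_of_gt hz)
  have hconv : Convex ℝ {z : ℂ | 0 < z.im} := convex_halfSpace_im_gt 0
  obtain ⟨c, hc⟩ := (((hF.sub hG).mono hsub).analyticOnNhd
    isOpen_upperHalfPlane).eq_const_of_im_eq_const (c₀ := 0)
    (fun z hz => by simp [him z hz]) isOpen_upperHalfPlane
    ⟨⟨Complex.I, by simp⟩, hconv.isPreconnected⟩
  -- `F - G` is constant; its value is found by going to infinity along the imaginary axis
  have hI : Tendsto (fun y : ℝ => (y : ℂ) * Complex.I) atTop (Bornology.cobounded ℂ) := by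
    rw [← tendsto_norm_atTop_iff_cobounded]
    simpa using tendsto_abs_atTop_atTop
  have h0 : Tendsto (fun y : ℝ => (F - G) ((y : ℂ) * Complex.I)) atTop (𝓝 0) := by
    have := (hF0.sub hG0).comp hI
    rwa [sub_zero] at this
  have hc0 : c = 0 := by
    refine tendsto_nhds_unique (tendsto_const_nhds.congr' ?_) h0
    filter_upwards [eventually_gt_atTop 0] with y hy
    exact (hc _ (by simpa using hy)).symm
  have := hc z hz
  rw [hc0] at this
  exact sub_eq_zero.1 this

/-- Representation of holomorphic functions with bounded imaginary part: a function holomorphic off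
`[a, b]`, real on the rest of the real axis and vanishing at infinity, whose imaginary part is bounded
on the upper half-plane with boundary values between `-π` and `0` on `(a, b)`, is the Stieltjes
transform of a density with values in `[0, 1]`. The density is a weak limit of `-Im L(t + iε) / π`. -/
theorem exists_density_eq_stieltjes {a b : ℝ} {L : ℂ → ℂ}
    (hd : DifferentiableOn ℂ L (offInterval a b))
    (hlim : Tendsto L (Bornology.cobounded ℂ) (𝓝 0))
    (hreal : ∀ x : ℝ, x ∉ Set.Icc a b → (L x).im = 0) {C : ℝ}
    (hC : ∀ z : ℂ, 0 < z.im → |(L z).im| ≤ C)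
    (hbd : ∀ t ∈ Set.Ioo a b, ∀ δ > 0, ∀ᶠ ε : ℝ in 𝓝[>] 0,
      -Real.pi - δ ≤ (L (t + ε * Complex.I)).im ∧ (L (t + ε * Complex.I)).im ≤ δ) :
    ∃ f : ℝ → ℝ, Measurable f ∧ (∀ x, 0 ≤ f x ∧ f x ≤ 1) ∧
      Set.EqOn L (stieltjes a b f) (offInterval a b) := by
  set ε : ℕ → ℝ := fun n => 1 / ((n : ℝ) + 1) with hεdef
  have hε : ∀ n, 0 < ε n := fun n => Nat.one_div_pos_of_nat
  have hε0 : Tendsto ε atTop (𝓝[>] 0) :=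
    tendsto_nhdsWithin_iff.2 ⟨tendsto_one_div_add_atTop_nhds_zero_nat, Eventually.of_forall hε⟩
  have hpi := Real.pi_pos
  set q : ℕ → ℝ → ℝ := fun n t => -(L (t + ε n * Complex.I)).im / Real.pi with hq
  -- `q n` takes values in `[0, 1]` only in the limit, hence the truncation
  set p : ℕ → ℝ → ℝ := fun n t => max 0 (min 1 (q n t)) with hp
  have hqm : ∀ n, Measurable (q n) := fun n => by
    have : Continuous fun t : ℝ => L (t + ε n * Complex.I) :=
      hd.continuousOn.comp_continuous (by fun_prop) fun t =>
        mem_offInterval_of_im_ne_zero (by simp [(hε n).ne'])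
    exact (Continuous.div_const (Complex.continuous_im.comp this).neg _).measurable
  have hpm : ∀ n, Measurable (p n) := fun n => measurable_const.max (measurable_const.min (hqm n))
  have hp01 : ∀ n t, 0 ≤ p n t ∧ p n t ≤ 1 := fun n t => ⟨le_max_left _ _, by simp [hp]⟩
  have hqC : ∀ n t, |q n t| ≤ C / Real.pi := fun n t => by
    rw [hq]
    simp only
    rw [abs_div, abs_neg, abs_of_pos hpi]
    gcongr
    exact hC _ (by simp [hε n])
  obtain ⟨f, hfm, hf01, 𝒰, h𝒰, h𝒰le, hweak⟩ :=
    exists_weak_limit (μ := volume.restrict (Set.Icc a b)) p hpm hp01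
  refine ⟨f, hfm, hf01, ?_⟩
  have hfint : IntegrableOn f (Set.Icc a b) :=
    Integrable.of_bound hfm.aestronglyMeasurable 1 (Eventually.of_forall fun x => by
      rw [Real.norm_eq_abs, abs_of_nonneg (hf01 x).1]
      exact (hf01 x).2)
  have him : ∀ u : ℂ, 0 < u.im → (L u).im = (stieltjes a b f u).im := by
    intro u hu
    set k : ℝ → ℝ := fun t => u.im / Complex.normSq (u - t) with hk
    have hkint : Integrable k := (integrable_inv_normSq_sub hu).const_mul u.im
    have hk0 : ∀ t, 0 ≤ k t := fun t => div_nonneg hu.le (Complex.normSq_nonneg _)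
    have hkm : Measurable k := by fun_prop
    have hkb : ∀ t, k t ≤ 1 / u.im := fun t => by
      rw [hk]
      simp only
      rw [normSq_ofReal_sub, div_le_div_iff₀ (by positivity) hu]
      nlinarith [sq_nonneg (t - u.re)]
    have hk2 : MemLp k 2 (volume.restrict (Set.Icc a b)) :=
      MemLp.of_bound hkm.aestronglyMeasurable (1 / u.im) (Eventually.of_forall fun t => by
        rw [Real.norm_eq_abs, abs_of_nonneg (hk0 t)]
        exact hkb t)
    have hqk : ∀ n, Integrable fun t => q n t * k t := fun n =>
      hkint.bdd_mul (c := C / Real.pi) (hqm n).aestronglyMeasurable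
        (Eventually.of_forall fun t => hqC n t)
    have hpk : ∀ n, Integrable fun t => p n t * k t := fun n =>
      hkint.bdd_mul (c := 1) (hpm n).aestronglyMeasurable
        (Eventually.of_forall fun t => by
          rw [Real.norm_eq_abs, abs_of_nonneg (hp01 n t).1]
          exact (hp01 n t).2)
    have hpoisson : ∀ n, (L (u + ε n * Complex.I)).im = -∫ t, q n t * k t := by
      intro n
      obtain ⟨B, hB⟩ := exists_norm_le_of_le_im hd hlim (hε n)
      have hP := poisson_upperHalfPlane (h := fun z => L (z + ε n * Complex.I)) (C := B) (hε n)
        (hd.comp (by fun_prop) fun z hz => mem_offInterval_of_im_ne_zero (by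
          simp only [Set.mem_ofPred_eq] at hz
          simp
          linarith)) (fun z hz => hB _ (by simpa using hz)) hu
      have hint : Integrable fun t : ℝ =>
          L (t + ε n * Complex.I) * ((Complex.normSq (u - t))⁻¹ : ℝ) := by
        refine (integrable_inv_normSq_sub hu).ofReal.bdd_mul (c := B) ?_
          (Eventually.of_forall fun t => hB _ (by simp))
        exact (hd.continuousOn.comp_continuous (by fun_prop) fun t =>
          mem_offInterval_of_im_ne_zero (by simp [(hε n).ne'])).aestronglyMeasurable
      have h1 := congrArg Complex.im hP
      have h2 := integral_im (𝕜 := ℂ) hint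
      simp only [RCLike.im_eq_complex_im, Complex.im_mul_ofReal] at h2
      rw [← h2, ← Complex.ofReal_div, Complex.im_mul_ofReal] at h1
      have h3 : ∀ t, q n t * k t = -(u.im / Real.pi) *
          ((L (t + ε n * Complex.I)).im * (Complex.normSq (u - t))⁻¹) := fun t => by
        simp only [hq, hk]
        field_simp
      simp only [h3]
      rw [integral_const_mul, ← h1]
      field_simp
    -- off `[a, b]`, `q n → 0` as `L` is real there; on `(a, b)`, `q n - p n → 0` by `hbd`
    have hdiff : Tendsto (fun n => (∫ t, q n t * k t) - ∫ t in Set.Icc a b, p n t * k t)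
        atTop (𝓝 0) := by
      have e1 : ∀ n, (∫ t, q n t * k t) - ∫ t in Set.Icc a b, p n t * k t =
          ∫ t, (q n t - (Set.Icc a b).indicator (p n) t) * k t := fun n => by
        rw [← integral_indicator measurableSet_Icc, ← integral_sub (hqk n)
          ((hpk n).indicator measurableSet_Icc)]
        congr 1 with t
        by_cases ht : t ∈ Set.Icc a b <;> simp [ht, sub_mul]
      simp only [e1]
      rw [← integral_zero ℝ ℝ]
      refine tendsto_integral_of_dominated_convergence (fun t => (C / Real.pi + 1) * k t)
        (fun n => (((hqm n).sub ((hpm n).indicator measurableSet_Icc)).mul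
          hkm).aestronglyMeasurable) (hkint.const_mul _) (fun n => Eventually.of_forall fun t => ?_) ?_
      · rw [norm_mul, Real.norm_eq_abs, Real.norm_eq_abs, abs_of_nonneg (hk0 t)]
        refine mul_le_mul_of_nonneg_right ((abs_sub _ _).trans (add_le_add (hqC n t) ?_)) (hk0 t)
        by_cases ht : t ∈ Set.Icc a b
        · simp [ht, abs_of_nonneg (hp01 n t).1, (hp01 n t).2]
        · simp [ht]
      · have hab : ∀ᵐ t : ℝ, t ≠ a ∧ t ≠ b := by
          filter_upwards [compl_mem_ae_iff.2 (measure_singleton a),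
            compl_mem_ae_iff.2 (measure_singleton b)] with t h1 h2 using ⟨h1, h2⟩
        filter_upwards [hab] with t ⟨hta, htb⟩
        rw [← zero_mul (k t)]
        refine Tendsto.mul_const _ ?_
        by_cases ht : t ∈ Set.Icc a b
        · simp only [ht, Set.indicator_of_mem]
          have ht' : t ∈ Set.Ioo a b := ⟨lt_of_le_of_ne ht.1 hta.symm, lt_of_le_of_ne ht.2 htb⟩
          rw [Metric.tendsto_nhds]
          intro η hη
          filter_upwards [hε0.eventually (hbd t ht' (Real.pi * (η / 2)) (by positivity))]
            with n ⟨hn1, hn2⟩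
          have hq1 : q n t ≤ 1 + η / 2 := by
            rw [hq]
            simp only
            rw [div_le_iff₀ hpi]
            linarith
          have hq2 : -(η / 2) ≤ q n t := by
            rw [hq]
            simp only
            rw [le_div_iff₀ hpi]
            linarith
          rw [Real.dist_eq, sub_zero, hp]
          simp only
          rw [abs_lt]
          grind
        · simp only [ht, not_false_eq_true, Set.indicator_of_notMem, sub_zero]
          have hcont : ContinuousAt L t := (hd.continuousOn).continuousAt
            ((isOpen_offInterval a b).mem_nhds (ofReal_mem_offInterval.2 ht))
          have harg : Tendsto (fun n => (t : ℂ) + ε n * Complex.I) atTop (𝓝 t) := by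
            have : Tendsto (fun x : ℝ => (t : ℂ) + x * Complex.I) (𝓝 0) (𝓝 t) :=
              Continuous.tendsto' (by fun_prop) _ _ (by simp)
            exact this.comp (tendsto_nhds_of_tendsto_nhdsWithin hε0)
          have := ((Complex.continuous_im.tendsto _).comp (hcont.tendsto.comp harg)).neg.div_const
            Real.pi
          rw [hreal t ht] at this
          simpa [hq] using this
    have hL : Tendsto (fun n => (L (u + ε n * Complex.I)).im) atTop (𝓝 (L u).im) := by
      have hcont : ContinuousAt L u := (hd.continuousOn).continuousAt
        ((isOpen_offInterval a b).mem_nhds (mem_offInterval_of_im_ne_zero hu.ne'))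
      have harg : Tendsto (fun n => u + ε n * Complex.I) atTop (𝓝 u) := by
        have : Tendsto (fun x : ℝ => u + x * Complex.I) (𝓝 0) (𝓝 u) :=
          Continuous.tendsto' (by fun_prop) _ _ (by simp)
        exact this.comp (tendsto_nhds_of_tendsto_nhdsWithin hε0)
      exact (Complex.continuous_im.tendsto _).comp (hcont.tendsto.comp harg)
    have h1 := ((hdiff.mono_left h𝒰le).add (hweak k hk2)).neg
    simp only [sub_add_cancel, zero_add, ← hpoisson] at h1
    rw [stieltjes_im hfint (mem_offInterval_of_im_ne_zero hu.ne')]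
    exact tendsto_nhds_unique (hL.mono_left h𝒰le) h1
  have hS := differentiableOn_stieltjes hfint
  refine eqOn_offInterval_of_eventuallyEq hd hS (z := Complex.I)
    (mem_offInterval_of_im_ne_zero (by simp)) ?_
  filter_upwards [isOpen_upperHalfPlane.mem_nhds (by simp : Complex.I ∈ {z : ℂ | 0 < z.im})] with z hz
  exact eqOn_upperHalfPlane_of_im_eq hd hS hlim (tendsto_stieltjes_cobounded hfint) him hz

/-! ### Moments and uniqueness -/

/-- If a Stieltjes transform vanishes near infinity, so do all moments of the density: the total mass is
the limit of `u S(u)`, and the transform of `t g(t)` is again zero near infinity. -/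
theorem integral_pow_mul_eq_zero {a b : ℝ} (k : ℕ) : ∀ {g : ℝ → ℝ}, IntegrableOn g (Set.Icc a b) →
    (∀ᶠ u in Bornology.cobounded ℂ, stieltjes a b g u = 0) →
    ∫ t in Set.Icc a b, t ^ k * g t = 0 := by
  have hmass : ∀ {g : ℝ → ℝ}, IntegrableOn g (Set.Icc a b) →
      (∀ᶠ u in Bornology.cobounded ℂ, stieltjes a b g u = 0) → ∫ t in Set.Icc a b, g t = 0 := by
    intro g hg h
    have h1 : Tendsto (fun u => u * stieltjes a b g u) (Bornology.cobounded ℂ) (𝓝 0) :=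
      tendsto_const_nhds.congr' (h.mono fun u hu => by simp [hu])
    exact_mod_cast tendsto_nhds_unique (tendsto_mul_stieltjes_cobounded hg) h1
  induction k with
  | zero => exact fun hg h => by simpa using hmass hg h
  | succ k ih =>
    intro g hg h
    have h0 := hmass hg h
    have := ih (g := fun t => t * g t) (hg.continuousOn_mul continuousOn_id isCompact_Icc) (by
      filter_upwards [h, eventually_mem_offInterval a b] with u hu hu'
      have := mul_stieltjes hg hu'
      simpa [h0, hu] using this.symm)
    simpa only [pow_succ, mul_assoc] using this

open Polynomial in
theorem integral_polynomial_mul_eq_zero {a b : ℝ} {g : ℝ → ℝ} (hg : IntegrableOn g (Set.Icc a b))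
    (h : ∀ k : ℕ, ∫ t in Set.Icc a b, t ^ k * g t = 0) (p : ℝ[X]) :
    ∫ t in Set.Icc a b, p.eval t * g t = 0 := by
  have hint : ∀ q : ℝ[X], IntegrableOn (fun t => q.eval t * g t) (Set.Icc a b) := fun q =>
    hg.continuousOn_mul q.continuous.continuousOn isCompact_Icc
  induction p using Polynomial.induction_on' with
  | add p q hp hq =>
    simp only [eval_add, add_mul]
    rw [integral_add (hint p) (hint q), hp, hq, add_zero]
  | monomial n c =>
    simp only [eval_monomial, mul_assoc]
    rw [integral_const_mul, h, mul_zero]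

/-- A density on `[a, b]` is determined by its Stieltjes transform near infinity. -/
theorem ae_eq_zero_of_stieltjes_eq_zero {a b : ℝ} {g : ℝ → ℝ} (hg : IntegrableOn g (Set.Icc a b))
    (h : ∀ᶠ u in Bornology.cobounded ℂ, stieltjes a b g u = 0) :
    ∀ᵐ t : ℝ, t ∈ Set.Icc a b → g t = 0 := by
  have hcont : ∀ φ : ℝ → ℝ, Continuous φ → ∫ t in Set.Icc a b, φ t * g t = 0 := by
    intro φ hφ
    have hφg : IntegrableOn (fun t => φ t * g t) (Set.Icc a b) :=
      hg.continuousOn_mul hφ.continuousOn isCompact_Icc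
    set A := ∫ t in Set.Icc a b, |g t|
    have hA : 0 ≤ A := integral_nonneg fun t => abs_nonneg _
    have hle : ∀ ε > 0, |∫ t in Set.Icc a b, φ t * g t| ≤ ε * A := by
      intro ε hε
      obtain ⟨p, hp⟩ := exists_polynomial_near_of_continuousOn a b φ hφ.continuousOn ε hε
      have hpg : IntegrableOn (fun t => p.eval t * g t) (Set.Icc a b) :=
        hg.continuousOn_mul p.continuous.continuousOn isCompact_Icc
      have e : ∫ t in Set.Icc a b, φ t * g t =
          ∫ t in Set.Icc a b, (φ t * g t - p.eval t * g t) := by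
        rw [integral_sub hφg hpg, integral_polynomial_mul_eq_zero hg
          (fun k => integral_pow_mul_eq_zero k hg h) p, sub_zero]
      rw [e, ← integral_const_mul, ← Real.norm_eq_abs]
      refine norm_integral_le_of_norm_le (hg.abs.const_mul ε) ?_
      filter_upwards [ae_restrict_mem measurableSet_Icc] with t ht
      rw [← sub_mul, norm_mul, Real.norm_eq_abs, Real.norm_eq_abs, abs_sub_comm]
      gcongr
      exact (hp t ht).le
    have : |∫ t in Set.Icc a b, φ t * g t| ≤ 0 := by
      refine le_of_forall_pos_le_add fun η hη => (hle (η / (A + 1)) (by positivity)).trans ?_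
      rw [zero_add, div_mul_eq_mul_div, div_le_iff₀ (by positivity)]
      nlinarith
    exact abs_nonpos_iff.1 this
  have hloc : LocallyIntegrable ((Set.Icc a b).indicator g) :=
    (hg.integrable_indicator measurableSet_Icc).locallyIntegrable
  have := ae_eq_zero_of_integral_contDiff_smul_eq_zero hloc fun φ hφ _ => by
    rw [← hcont φ hφ.continuous, ← integral_indicator measurableSet_Icc]
    congr 1 with t
    by_cases ht : t ∈ Set.Icc a b <;> simp [ht]
  filter_upwards [this] with t ht htI
  simpa [htI] using ht

/-- The Stieltjes transform generates the moments: `S(1 / z) = ∑ m_k z ^ (k + 1)` for small `z`. -/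
theorem hasSum_moments {a b : ℝ} {g : ℝ → ℝ} (hg : IntegrableOn g (Set.Icc a b)) {z : ℂ}
    (hz : z ≠ 0) (hzb : ‖z‖ * max |a| |b| < 1) :
    HasSum (fun k : ℕ => ((∫ t in Set.Icc a b, t ^ k * g t : ℝ) : ℂ) * z ^ (k + 1))
      (stieltjes a b g z⁻¹) := by
  set M := max |a| |b|
  have hM : ∀ t ∈ Set.Icc a b, |t| ≤ M := fun t ht => abs_le_max_abs_abs ht.1 ht.2
  have hM0 : 0 ≤ M := (abs_nonneg a).trans (le_max_left _ _)
  have hint : ∀ k : ℕ, IntegrableOn (fun t => t ^ k * g t) (Set.Icc a b) := fun k =>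
    hg.continuousOn_mul (by fun_prop) isCompact_Icc
  set F : ℕ → ℝ → ℂ := fun k t => ((t ^ k * g t : ℝ) : ℂ) * z ^ (k + 1) with hF
  have hFi : ∀ k, Integrable (F k) (volume.restrict (Set.Icc a b)) := fun k =>
    (hint k).ofReal.mul_const _
  have hsum : Summable fun k => ∫ t in Set.Icc a b, ‖F k t‖ := by
    refine Summable.of_nonneg_of_le (fun k => integral_nonneg fun t => norm_nonneg _) (fun k => ?_)
      ((summable_geometric_of_lt_one (by positivity) hzb).mul_left
        (‖z‖ * ∫ t in Set.Icc a b, |g t|))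
    have : (‖z‖ * ∫ t in Set.Icc a b, |g t|) * (‖z‖ * M) ^ k =
        ∫ t in Set.Icc a b, ‖z‖ * (‖z‖ * M) ^ k * |g t| := by
      rw [integral_const_mul]
      ring
    rw [this]
    refine setIntegral_mono_on (hFi k).norm (hg.abs.const_mul _) measurableSet_Icc fun t ht => ?_
    rw [hF]
    simp only
    rw [norm_mul, norm_pow, Complex.norm_real, Real.norm_eq_abs, abs_mul, abs_pow, mul_pow, pow_succ]
    have h2 : |t| ^ k ≤ M ^ k := by gcongr; exact hM t ht
    calc |t| ^ k * |g t| * (‖z‖ ^ k * ‖z‖) ≤ M ^ k * |g t| * (‖z‖ ^ k * ‖z‖) := by gcongr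
      _ = ‖z‖ * (‖z‖ ^ k * M ^ k) * |g t| := by ring
  have key := hasSum_integral_of_summable_integral_norm hFi hsum
  have e1 : ∀ k, ∫ t in Set.Icc a b, F k t =
      ((∫ t in Set.Icc a b, t ^ k * g t : ℝ) : ℂ) * z ^ (k + 1) := fun k => by
    rw [hF]
    simp only
    rw [integral_mul_const, integral_complex_ofReal]
  have e2 : ∫ t in Set.Icc a b, ∑' k, F k t = stieltjes a b g z⁻¹ := by
    refine setIntegral_congr_fun measurableSet_Icc fun t ht => ?_
    have hlt : ‖(t : ℂ) * z‖ < 1 := by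
      rw [norm_mul, Complex.norm_real, Real.norm_eq_abs, mul_comm]
      exact (mul_le_mul_of_nonneg_left (hM t ht) (norm_nonneg z)).trans_lt hzb
    have hne : 1 - (t : ℂ) * z ≠ 0 := fun h0 => by
      rw [← sub_eq_zero.1 h0] at hlt
      simp at hlt
    have : ∀ k, F k t = z * (g t : ℂ) * ((t : ℂ) * z) ^ k := fun k => by
      simp only [hF]
      push_cast
      ring
    simp only [this]
    rw [tsum_mul_left, tsum_geometric_of_norm_lt_one hlt]
    have e3 : z⁻¹ - (t : ℂ) = (1 - t * z) / z := by field_simp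
    rw [e3]
    field_simp
  simpa only [e1, e2] using key

/-! ### Slope densities of diagrams -/

/-- The density `(1 - w') / 2` of the slope of a diagram. -/
noncomputable def slopeDensity (w : ℝ → ℝ) (t : ℝ) : ℝ := (1 - deriv w t) / 2

theorem Diagrams.lipschitzWith {a b : ℝ} {w : ℝ → ℝ} (hw : w ∈ Diagrams a b) : LipschitzWith 1 w :=
  LipschitzWith.of_dist_le_mul fun x y => by simpa [Real.dist_eq] using hw.1.1 x y

theorem LipschitzWith.integral_deriv_eq_sub {w : ℝ → ℝ} {C : NNReal} (hw : LipschitzWith C w)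
    (x y : ℝ) : ∫ t in x..y, deriv w t = w y - w x :=
  (hw.lipschitzOnWith (s := Set.uIcc x y)).absolutelyContinuousOnInterval.integral_deriv_eq_sub

theorem measurable_slopeDensity (w : ℝ → ℝ) : Measurable (slopeDensity w) :=
  ((measurable_deriv w).const_sub 1).div_const 2

theorem slopeDensity_mem {w : ℝ → ℝ} (hw : LipschitzWith 1 w) (t : ℝ) :
    0 ≤ slopeDensity w t ∧ slopeDensity w t ≤ 1 := by
  have := norm_deriv_le_of_lipschitz (x₀ := t) hw
  rw [Real.norm_eq_abs, NNReal.coe_one, abs_le] at this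
  unfold slopeDensity
  constructor <;> linarith

theorem integrableOn_of_mem_unitInterval {g : ℝ → ℝ} (hg : Measurable g)
    (h01 : ∀ t, 0 ≤ g t ∧ g t ≤ 1) (a b : ℝ) : IntegrableOn g (Set.Icc a b) :=
  Integrable.of_bound hg.aestronglyMeasurable 1 (Eventually.of_forall fun x => by
    rw [Real.norm_eq_abs, abs_of_nonneg (h01 x).1]
    exact (h01 x).2)

theorem integrableOn_slopeDensity {w : ℝ → ℝ} (hw : LipschitzWith 1 w) (a b : ℝ) :
    IntegrableOn (slopeDensity w) (Set.Icc a b) :=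
  integrableOn_of_mem_unitInterval (measurable_slopeDensity w) (slopeDensity_mem hw) a b

/-- The centre of a diagram, with the formulas for `w` on the two rays including their end points. -/
theorem Diagrams.exists_center {a b : ℝ} {w : ℝ → ℝ} (hw : w ∈ Diagrams a b) :
    ∃ x₀ ∈ Set.Icc a b, (∀ x ≤ a, w x = x₀ - x) ∧ ∀ x, b ≤ x → w x = x - x₀ := by
  have hc := (Diagrams.lipschitzWith hw).continuous
  obtain ⟨-, x₀, hx₀, h⟩ := hw
  have hcl : IsClosed {x | w x = |x - x₀|} := isClosed_eq hc (by fun_prop)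
  have h1 : Set.Iic a ⊆ {x | w x = |x - x₀|} := by
    rw [← closure_Iio]
    exact hcl.closure_subset_iff.2 fun x hx => h x fun hx' => not_le.2 hx hx'.1
  have h2 : Set.Ici b ⊆ {x | w x = |x - x₀|} := by
    rw [← closure_Ioi]
    exact hcl.closure_subset_iff.2 fun x hx => h x fun hx' => not_le.2 hx hx'.2
  refine ⟨x₀, hx₀, fun x hx => ?_, fun x hx => ?_⟩
  · rw [h1 hx, abs_of_nonpos (by linarith [hx₀.1])]
    ring
  · rw [h2 hx, abs_of_nonneg (by linarith [hx₀.2])]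

theorem slopeDensity_of_lt {a b : ℝ} {w : ℝ → ℝ} (hw : w ∈ Diagrams a b) {t : ℝ} (ht : t < a) :
    slopeDensity w t = 1 := by
  obtain ⟨x₀, -, h, -⟩ := Diagrams.exists_center hw
  have : w =ᶠ[𝓝 t] fun x => x₀ - x := (eventually_lt_nhds ht).mono fun x hx => h x hx.le
  rw [slopeDensity, this.deriv_eq]
  simp

theorem slopeDensity_of_gt {a b : ℝ} {w : ℝ → ℝ} (hw : w ∈ Diagrams a b) {t : ℝ} (ht : b < t) :
    slopeDensity w t = 0 := by
  obtain ⟨x₀, -, -, h⟩ := Diagrams.exists_center hw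
  have : w =ᶠ[𝓝 t] fun x => x - x₀ := (eventually_gt_nhds ht).mono fun x hx => h x hx.le
  rw [slopeDensity, this.deriv_eq]
  simp

theorem integral_slopeDensity {w : ℝ → ℝ} (hw : LipschitzWith 1 w) {x y : ℝ} (hxy : x ≤ y) :
    ∫ t in Set.Icc x y, slopeDensity w t = ((y - x) - (w y - w x)) / 2 := by
  have hd : IntervalIntegrable (deriv w) volume x y :=
    (hw.lipschitzOnWith (s := Set.uIcc x y)).absolutelyContinuousOnInterval.intervalIntegrable_deriv
  rw [integral_Icc_eq_integral_Ioc, ← intervalIntegral.integral_of_le hxy]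
  simp only [slopeDensity]
  rw [intervalIntegral.integral_div, intervalIntegral.integral_sub (by simp) hd,
    LipschitzWith.integral_deriv_eq_sub hw]
  simp

/-- A diagram is determined by its slope density on `[a, b]`. -/
theorem Diagrams.ext_of_slopeDensity {a b : ℝ} (hab : a ≤ b) {w v : ℝ → ℝ} (hw : w ∈ Diagrams a b)
    (hv : v ∈ Diagrams a b)
    (h : ∀ᵐ t : ℝ, t ∈ Set.Icc a b → slopeDensity w t = slopeDensity v t) : w = v := by
  have hwl := Diagrams.lipschitzWith hw
  have hvl := Diagrams.lipschitzWith hv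
  obtain ⟨x₀, hx₀, hw1, hw2⟩ := Diagrams.exists_center hw
  obtain ⟨y₀, hy₀, hv1, hv2⟩ := Diagrams.exists_center hv
  have hint : ∀ x ∈ Set.Icc a b, ∫ t in Set.Icc a x, slopeDensity w t =
      ∫ t in Set.Icc a x, slopeDensity v t := fun x hx =>
    setIntegral_congr_ae measurableSet_Icc (h.mono fun t ht htx => ht ⟨htx.1, htx.2.trans hx.2⟩)
  have hb := hint b (Set.right_mem_Icc.2 hab)
  rw [integral_slopeDensity hwl hab, integral_slopeDensity hvl hab, hw1 a le_rfl, hv1 a le_rfl,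
    hw2 b le_rfl, hv2 b le_rfl] at hb
  have hxy : x₀ = y₀ := by linarith
  funext x
  by_cases hxa : x ≤ a
  · rw [hw1 x hxa, hv1 x hxa, hxy]
  by_cases hxb : b ≤ x
  · rw [hw2 x hxb, hv2 x hxb, hxy]
  push Not at hxa hxb
  have hx := hint x ⟨hxa.le, hxb.le⟩
  rw [integral_slopeDensity hwl hxa.le, integral_slopeDensity hvl hxa.le, hw1 a le_rfl,
    hv1 a le_rfl] at hx
  linarith

theorem basePoint_mem {a b : ℝ} (hab : a ≤ b) : basePoint a b ∈ Set.Icc a b :=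
  ⟨le_max_left _ _, max_le hab (min_le_right _ _)⟩

/-- `R_w(u) = exp (S(u)) / (u - a)` with `S` the Stieltjes transform of the slope density. The base
point drops out because `(u - a) / (u - c)` is itself the exponential of a Stieltjes transform. -/
theorem diagramR_mul_sub {a b : ℝ} (hab : a ≤ b) {w : ℝ → ℝ} (hw : w ∈ Diagrams a b) {u : ℂ}
    (hu : u ∈ offInterval a b) :
    diagramR a b w u * (u - a) = Complex.exp (stieltjes a b (slopeDensity w) u) := by
  have hwl := Diagrams.lipschitzWith hw
  have hcm := basePoint_mem hab
  set c := basePoint a b with hc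
  have h1 := exp_stieltjes_one hcm.1 (Set.Icc_subset_Icc_right hcm.2) hu
  have hca : u - (c : ℂ) ≠ 0 := sub_ne_zero_of_mem_offInterval hu hcm
  have hσ : ∫ t in Set.Icc a b, ((deriv (diagramSigma c w) t : ℝ) : ℂ) / ((t : ℂ) - u) =
      stieltjes a b (slopeDensity w) u - stieltjes a c (fun _ => 1) u := by
    have h2 : stieltjes a c (fun _ => 1) u =
        stieltjes a b ((Set.Iic c).indicator fun _ => 1) u := by
      have hI : Set.Icc a c = Set.Icc a b ∩ Set.Iic c := by
        ext t
        simp only [Set.mem_Icc, Set.mem_inter_iff, Set.mem_Iic]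
        have := hcm.2
        constructor
        · rintro ⟨h, h'⟩
          exact ⟨⟨h, h'.trans this⟩, h'⟩
        · rintro ⟨⟨h, -⟩, h'⟩
          exact ⟨h, h'⟩
      unfold stieltjes
      rw [hI, ← setIntegral_indicator measurableSet_Iic]
      congr 1 with t
      by_cases ht : t ∈ Set.Iic c <;> simp [ht]
    have hind : IntegrableOn ((Set.Iic c).indicator fun _ => (1 : ℝ)) (Set.Icc a b) :=
      (integrableOn_const (by simp)).indicator measurableSet_Iic
    rw [h2]
    unfold stieltjes
    rw [← integral_sub (integrableOn_div_sub (integrableOn_slopeDensity hwl a b) hu)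
      (integrableOn_div_sub hind hu)]
    refine setIntegral_congr_ae measurableSet_Icc ?_
    -- at points where `w` is not differentiable `deriv` is a junk value; they form a null set
    filter_upwards [hwl.ae_differentiableAt_real, compl_mem_ae_iff.2 (measure_singleton c)]
      with t hdt htc ht
    have hne := sub_ne_zero_of_mem_offInterval hu ht
    have hder : deriv (diagramSigma c w) t =
        (Set.Iic c).indicator (fun _ => (1 : ℝ)) t - slopeDensity w t := by
      rcases lt_or_gt_of_ne (show t ≠ c from htc) with hlt | hgt
      · have he : diagramSigma c w =ᶠ[𝓝 t] fun x => (w x - (c - x)) / 2 :=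
          (eventually_lt_nhds hlt).mono fun x hx => by
            rw [diagramSigma, abs_of_neg (sub_neg.2 hx), neg_sub]
        have hd := (hdt.hasDerivAt.sub ((hasDerivAt_id t).const_sub c)).div_const 2
        rw [he.deriv_eq]
        refine hd.deriv.trans ?_
        rw [Set.indicator_of_mem (show t ∈ Set.Iic c from hlt.le), slopeDensity]
        ring
      · have he : diagramSigma c w =ᶠ[𝓝 t] fun x => (w x - (x - c)) / 2 :=
          (eventually_gt_nhds hgt).mono fun x hx => by
            rw [diagramSigma, abs_of_pos (sub_pos.2 hx)]
        have hd := (hdt.hasDerivAt.sub ((hasDerivAt_id t).sub_const c)).div_const 2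
        rw [he.deriv_eq]
        refine hd.deriv.trans ?_
        rw [Set.indicator_of_notMem (show t ∉ Set.Iic c from not_le.2 hgt), slopeDensity]
        ring
    rw [hder, ← neg_sub u (t : ℂ), div_neg, Complex.ofReal_sub]
    ring
  unfold diagramR
  rw [← hc, hσ, Complex.exp_sub, ← h1]
  have := Complex.exp_ne_zero (stieltjes a c (fun _ => 1) u)
  field_simp

/-- `p_k(w) = a ^ k + k ∫ t ^ (k - 1) G(t) dt` with `G` the slope density: integrate by parts once
against the absolutely continuous function `w`; as `G = 1` to the left of `a` and `G = 0` to the right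
of `b`, the remaining integral `∫ G φ'` is `φ(a) + ∫_a^b G φ'`. -/
theorem diagramMoment_succ {a b : ℝ} (hab : a ≤ b) {w : ℝ → ℝ} (hw : w ∈ Diagrams a b) (k : ℕ) :
    diagramMoment a b w (k + 1) =
      a ^ (k + 1) + (k + 1) * ∫ t in Set.Icc a b, t ^ k * slopeDensity w t := by
  have hwl := Diagrams.lipschitzWith hw
  set φ : ℝ → ℝ := fun t => intervalCutoff a b t * t ^ (k + 1) with hφdef
  have hφ : ContDiff ℝ 2 φ := (intervalCutoff a b).contDiff.mul (contDiff_fun_id.pow _)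
  have hφc : HasCompactSupport φ := (intervalCutoff a b).hasCompactSupport.mul_right
  have hnear : ∀ x ∈ Set.Icc a b, φ =ᶠ[𝓝 x] fun t => t ^ (k + 1) := by
    intro x hx
    have hmem : x ∈ Metric.ball ((a + b) / 2) (intervalCutoff a b).rIn := by
      have hr : (intervalCutoff a b).rIn = |b - a| / 2 + 1 := rfl
      rw [Metric.mem_ball, Real.dist_eq, hr, abs_of_nonneg (a := b - a) (by linarith), abs_lt]
      constructor <;> linarith [hx.1, hx.2]
    filter_upwards [(intervalCutoff a b).eventuallyEq_one_of_mem_ball hmem] with t ht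
    simp [hφdef, ht]
  have hφ1 : ContDiff ℝ 1 (deriv φ) := hφ.deriv'
  have hφ'c : Continuous (deriv φ) := hφ1.continuous
  have hφ''c : Continuous (deriv (deriv φ)) := hφ1.continuous_deriv le_rfl
  -- `φ` and its derivatives vanish off `(-N, N)`, so the integrals may be taken over `[-N, N]`
  obtain ⟨M, hM⟩ : ∃ M, ∀ x, M ≤ |x| → φ x = 0 ∧ deriv φ x = 0 ∧ deriv (deriv φ) x = 0 := by
    obtain ⟨M, hM⟩ := hφc.isCompact.isBounded.subset_closedBall 0
    refine ⟨M + 1, fun x hx => ?_⟩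
    have hx' : x ∉ tsupport φ := fun h => by
      have := hM h
      rw [mem_closedBall_zero_iff, Real.norm_eq_abs] at this
      linarith
    exact ⟨image_eq_zero_of_notMem_tsupport hx', image_eq_zero_of_notMem_tsupport
      fun h => hx' (tsupport_deriv_subset h), image_eq_zero_of_notMem_tsupport
      fun h => hx' (tsupport_deriv_subset (tsupport_deriv_subset h))⟩
  set N := max M (max |a| |b|) + 1 with hN
  have hNa : |a| < N := by
    have := le_max_left |a| |b|
    have := le_max_right M (max |a| |b|)
    linarith
  have hNb : |b| < N := by
    have := le_max_right |a| |b|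
    have := le_max_right M (max |a| |b|)
    linarith
  have hNM : M ≤ N := by
    have := le_max_left M (max |a| |b|)
    linarith
  have hN0 : 0 < N := (abs_nonneg a).trans_lt hNa
  have hA := abs_lt.1 hNa
  have hB := abs_lt.1 hNb
  have hNp := hM N (hNM.trans (le_abs_self N))
  have hNn := hM (-N) (by rw [abs_neg]; exact hNM.trans (le_abs_self N))
  have hFTC : ∀ x y, ∫ t in x..y, deriv φ t = φ y - φ x := fun x y =>
    intervalIntegral.integral_deriv_eq_sub (fun t _ => hφ.differentiable (by norm_num) t)
      (hφ'c.intervalIntegrable _ _)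
  have e1 : secondDerivPairing w φ = ∫ x in -N..N, w x * deriv (deriv φ) x := by
    unfold secondDerivPairing
    rw [intervalIntegral.integral_of_le (by linarith)]
    refine (setIntegral_eq_integral_of_forall_compl_eq_zero fun x hx => ?_).symm
    have : M ≤ |x| := by
      refine hNM.trans ?_
      by_contra! h
      have := abs_lt.1 h
      exact hx ⟨this.1, this.2.le⟩
    rw [(hM x this).2.2, mul_zero]
  have hac : AbsolutelyContinuousOnInterval w (-N) N :=
    (hwl.lipschitzOnWith (s := Set.uIcc (-N) N)).absolutelyContinuousOnInterval
  have e2 : ∫ x in -N..N, w x * deriv (deriv φ) x = -∫ x in -N..N, deriv w x * deriv φ x := by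
    have := hac.integral_mul_deriv_eq_deriv_mul
      (ContDiffOn.absolutelyContinuousOnInterval (hφ1.contDiffOn (s := Set.uIcc (-N) N)))
    rw [this, hNp.2.1, hNn.2.1]
    simp
  have hdi : ∀ x y, IntervalIntegrable (fun t => slopeDensity w t * deriv φ t) volume x y :=
    fun x y => (((integrableOn_slopeDensity hwl (min x y) (max x y)).mul_continuousOn
      hφ'c.continuousOn isCompact_Icc).intervalIntegrable)
  have e3 : ∫ x in -N..N, deriv w x * deriv φ x = -2 * ∫ x in -N..N, slopeDensity w x * deriv φ x := by
    have h : ∀ x, deriv w x * deriv φ x = deriv φ x - 2 * (slopeDensity w x * deriv φ x) := fun x => by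
      rw [slopeDensity]
      ring
    simp only [h]
    rw [intervalIntegral.integral_sub (hφ'c.intervalIntegrable _ _) ((hdi _ _).const_mul 2), hFTC,
      hNp.1, hNn.1, intervalIntegral.integral_const_mul]
    ring
  have e4 : ∫ x in -N..a, slopeDensity w x * deriv φ x = φ a := by
    have : ∫ x in -N..a, slopeDensity w x * deriv φ x = ∫ x in -N..a, deriv φ x := by
      refine intervalIntegral.integral_congr_ae ?_
      filter_upwards [compl_mem_ae_iff.2 (measure_singleton a)] with t hta ht
      rw [Set.uIoc_of_le hA.1.le] at ht
      rw [slopeDensity_of_lt hw (lt_of_le_of_ne ht.2 hta), one_mul]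
    rw [this, hFTC, hNn.1, sub_zero]
  have e5 : ∫ x in b..N, slopeDensity w x * deriv φ x = 0 := by
    rw [intervalIntegral.integral_of_le hB.2.le]
    refine setIntegral_eq_zero_of_forall_eq_zero fun t ht => ?_
    rw [slopeDensity_of_gt hw ht.1, zero_mul]
  have e6 : ∫ x in a..b, slopeDensity w x * deriv φ x =
      (k + 1) * ∫ t in Set.Icc a b, t ^ k * slopeDensity w t := by
    rw [intervalIntegral.integral_of_le hab, ← integral_Icc_eq_integral_Ioc, ← integral_const_mul]
    refine setIntegral_congr_fun measurableSet_Icc fun t ht => ?_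
    have := (hnear t ht).deriv_eq
    simp only [this]
    simp
    ring
  have e7 : ∫ x in -N..N, slopeDensity w x * deriv φ x =
      φ a + (k + 1) * ∫ t in Set.Icc a b, t ^ k * slopeDensity w t := by
    rw [← intervalIntegral.integral_add_adjacent_intervals (hdi (-N) a) (hdi a N),
      ← intervalIntegral.integral_add_adjacent_intervals (hdi a b) (hdi b N), e4, e5, e6, add_zero]
  have hφa : φ a = a ^ (k + 1) := (hnear a (Set.left_mem_Icc.2 hab)).eq_of_nhds
  unfold diagramMoment
  rw [e1, e2, e3, e7, hφa]
  ring

/-! ### Measures with bounded density and the moment relation -/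

/-- A density on `[a, b]` is determined by the exponential of its Stieltjes transform near infinity,
where the transform is small and hence the principal logarithm of its exponential. -/
theorem ae_eq_of_exp_stieltjes_eq {a b : ℝ} {f g : ℝ → ℝ} (hf : IntegrableOn f (Set.Icc a b))
    (hg : IntegrableOn g (Set.Icc a b))
    (h : ∀ᶠ u in Bornology.cobounded ℂ,
      Complex.exp (stieltjes a b f u) = Complex.exp (stieltjes a b g u)) :
    ∀ᵐ t : ℝ, t ∈ Set.Icc a b → f t = g t := by
  have hlog : ∀ {k : ℝ → ℝ}, IntegrableOn k (Set.Icc a b) → ∀ᶠ u in Bornology.cobounded ℂ,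
      Complex.log (Complex.exp (stieltjes a b k u)) = stieltjes a b k u := by
    intro k hk
    filter_upwards [(tendsto_zero_iff_norm_tendsto_zero.1
      (tendsto_stieltjes_cobounded hk)).eventually_lt_const one_pos] with u hu
    have h1 := abs_le.1 (Complex.abs_im_le_norm (stieltjes a b k u))
    have := Real.pi_gt_three
    exact Complex.log_exp (by linarith) (by linarith)
  have h0 := ae_eq_zero_of_stieltjes_eq_zero (hf.sub hg) (by
    filter_upwards [h, hlog hf, hlog hg, eventually_mem_offInterval a b] with u hu h1 h2 hu'
    have h3 : stieltjes a b (f - g) u = stieltjes a b f u - stieltjes a b g u := by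
      unfold stieltjes
      rw [← integral_sub (integrableOn_div_sub hf hu') (integrableOn_div_sub hg hu')]
      congr 1 with t
      simp [sub_div]
    rw [h3, ← h1, ← h2, hu, sub_self])
  filter_upwards [h0] with t ht htI using sub_eq_zero.1 (ht htI)

/-- A measure with bounded density, in the form in which the integrals against it are computed: with
Lebesgue measure restricted to `[a, b]` as the reference measure. -/
theorem BoundedDensityMeasures.exists_density {a b : ℝ} {ψ : Measure ℝ}
    (hψ : ψ ∈ BoundedDensityMeasures a b) :
    ∃ f : ℝ → ℝ, Measurable f ∧ (∀ x, 0 ≤ f x ∧ f x ≤ 1) ∧ ∫ t in Set.Icc a b, f t = 1 ∧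
      ψ = (volume.restrict (Set.Icc a b)).withDensity (fun x => ENNReal.ofReal (f x)) := by
  obtain ⟨hp, hsupp, f, hf, h01, rfl⟩ := hψ
  set ψ := volume.withDensity (fun x => ENNReal.ofReal (f x)) with hψ
  have hres : ψ = (volume.restrict (Set.Icc a b)).withDensity (fun x => ENNReal.ofReal (f x)) := by
    rw [← restrict_withDensity measurableSet_Icc, ← hψ]
    exact (Measure.restrict_eq_self_of_ae_mem (mem_ae_iff.2 hsupp)).symm
  refine ⟨f, hf, h01, ?_, hres⟩
  have h1 : ψ Set.univ = 1 := measure_univ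
  rw [hres, withDensity_apply _ MeasurableSet.univ, Measure.restrict_univ,
    ← ofReal_integral_eq_lintegral_ofReal (integrableOn_of_mem_unitInterval hf h01 a b)
      (Eventually.of_forall fun x => (h01 x).1)] at h1
  exact ENNReal.ofReal_eq_one.1 h1

theorem integral_withDensity_Icc {E : Type*} [NormedAddCommGroup E] [NormedSpace ℝ E] {a b : ℝ}
    {f : ℝ → ℝ} (hf : Measurable f) (h0 : ∀ x, 0 ≤ f x) (φ : ℝ → E) :
    ∫ t, φ t ∂(volume.restrict (Set.Icc a b)).withDensity (fun x => ENNReal.ofReal (f x)) =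
      ∫ t in Set.Icc a b, f t • φ t := by
  rw [integral_withDensity_eq_integral_toReal_smul (by fun_prop) (by simp)]
  simp only [ENNReal.toReal_ofReal (h0 _)]

theorem measureR_withDensity {a b : ℝ} {f : ℝ → ℝ} (hf : Measurable f) (h0 : ∀ x, 0 ≤ f x) (u : ℂ) :
    measureR a b ((volume.restrict (Set.Icc a b)).withDensity (fun x => ENNReal.ofReal (f x))) u =
      -1 + Complex.exp (stieltjes a b f u) := by
  unfold measureR stieltjes
  rw [restrict_withDensity measurableSet_Icc, Measure.restrict_restrict measurableSet_Icc,
    Set.inter_self, integral_withDensity_Icc hf h0]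
  congr 3 with t
  simp [div_eq_mul_inv]

theorem measureMoment_withDensity {a b : ℝ} {f : ℝ → ℝ} (hf : Measurable f) (h0 : ∀ x, 0 ≤ f x)
    (k : ℕ) :
    measureMoment ((volume.restrict (Set.Icc a b)).withDensity (fun x => ENNReal.ofReal (f x))) k =
      ∫ t in Set.Icc a b, t ^ k * f t := by
  unfold measureMoment
  rw [integral_withDensity_Icc hf h0]
  simp only [smul_eq_mul, mul_comm]

/-- Under `u = 1 / z` the two sides of the moment relation are `u R_ψ(u)` and `u R_w(u)`. -/
theorem momentRelation_iff_eventually {a b : ℝ} (hab : a ≤ b) {ψ : Measure ℝ}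
    (hψ : ψ ∈ BoundedDensityMeasures a b) {w : ℝ → ℝ} (hw : w ∈ Diagrams a b) :
    MomentRelation a b ψ w ↔
      ∀ᶠ u in Bornology.cobounded ℂ, measureR a b ψ u = diagramR a b w u := by
  obtain ⟨f, hf, h01, -, rfl⟩ := BoundedDensityMeasures.exists_density hψ
  have hfi := integrableOn_of_mem_unitInterval hf h01 a b
  have hgi := integrableOn_slopeDensity (Diagrams.lipschitzWith hw) a b
  rw [← inv_nhdsNE_zero]
  change _ ↔ ∀ᶠ z : ℂ in 𝓝[≠] 0, measureR a b _ z⁻¹ = diagramR a b w z⁻¹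
  refine eventually_congr ?_
  have hsmall : ∀ᶠ z : ℂ in 𝓝[≠] 0, ‖z‖ * max |a| |b| < 1 := by
    refine eventually_nhdsWithin_of_eventually_nhds ?_
    have : Tendsto (fun z : ℂ => ‖z‖ * max |a| |b|) (𝓝 0) (𝓝 0) :=
      Continuous.tendsto' (by fun_prop) _ _ (by simp)
    exact this.eventually_lt_const one_pos
  filter_upwards [hsmall, self_mem_nhdsWithin,
    tendsto_inv₀_nhdsNE_zero.eventually (eventually_mem_offInterval a b)] with z hzb hz hzoff
  have hz : z ≠ 0 := hz
  have haz : ‖(a : ℂ) * z‖ < 1 := by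
    rw [norm_mul, Complex.norm_real, Real.norm_eq_abs, mul_comm]
    exact (mul_le_mul_of_nonneg_left (le_max_left _ _) (norm_nonneg z)).trans_lt hzb
  have hne : 1 - (a : ℂ) * z ≠ 0 := fun h0 => by
    rw [← sub_eq_zero.1 h0] at haz
    simp at haz
  have hF := hasSum_moments hfi hz hzb
  have hψsum : HasSum (fun k : ℕ => (measureMoment ((volume.restrict (Set.Icc a b)).withDensity
      (fun x => ENNReal.ofReal (f x))) k : ℂ) * z ^ k) (z⁻¹ * stieltjes a b f z⁻¹) := by
    have := hF.mul_left z⁻¹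
    refine this.congr_fun fun k => ?_
    rw [measureMoment_withDensity hf fun x => (h01 x).1]
    field_simp
    ring
  have hwsum : HasSum (fun k : ℕ => (diagramMoment a b w (k + 1) : ℂ) / ((k : ℂ) + 1) * z ^ (k + 1))
      (-Complex.log (1 - a * z) + stieltjes a b (slopeDensity w) z⁻¹) := by
    refine ((Complex.hasSum_taylorSeries_neg_log' haz).add (hasSum_moments hgi hz hzb)).congr_fun
      fun k => ?_
    rw [diagramMoment_succ hab hw]
    have : (k : ℂ) + 1 ≠ 0 := Nat.cast_add_one_ne_zero k
    push_cast
    field_simp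
    ring
  have hR := diagramR_mul_sub hab hw hzoff
  rw [hψsum.tsum_eq, hwsum.tsum_eq, Complex.exp_add, Complex.exp_neg, Complex.exp_log hne, ← hR,
    measureR_withDensity hf fun x => (h01 x).1]
  have e1 : z * (z⁻¹ * stieltjes a b f z⁻¹) = stieltjes a b f z⁻¹ := by field_simp
  have e2 : (1 - (a : ℂ) * z)⁻¹ * (diagramR a b w z⁻¹ * (z⁻¹ - a)) = 1 / z * diagramR a b w z⁻¹ := by
    field_simp
  rw [e1, e2, mul_right_inj' (one_div_ne_zero hz)]
  exact ⟨fun h => h.2.2, fun h => ⟨hψsum.summable, hwsum.summable, h⟩⟩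

theorem differentiableOn_diagramR {a b : ℝ} (hab : a ≤ b) {w : ℝ → ℝ} (hw : w ∈ Diagrams a b) :
    DifferentiableOn ℂ (diagramR a b w) (offInterval a b) := by
  have hne : ∀ u ∈ offInterval a b, u - (a : ℂ) ≠ 0 := fun u hu =>
    sub_ne_zero_of_mem_offInterval hu (Set.left_mem_Icc.2 hab)
  refine DifferentiableOn.congr (f := fun u => Complex.exp (stieltjes a b (slopeDensity w) u) /
    (u - a)) ?_ fun u hu => (eq_div_iff (hne u hu)).2 (diagramR_mul_sub hab hw hu)
  exact (differentiableOn_stieltjes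
    (integrableOn_slopeDensity (Diagrams.lipschitzWith hw) a b)).cexp.div (by fun_prop) hne

theorem eqOn_offInterval_of_eventuallyEq_cobounded {a b : ℝ} {F G : ℂ → ℂ}
    (hF : DifferentiableOn ℂ F (offInterval a b)) (hG : DifferentiableOn ℂ G (offInterval a b))
    (h : ∀ᶠ u in Bornology.cobounded ℂ, F u = G u) : Set.EqOn F G (offInterval a b) := by
  obtain ⟨R, -, hR⟩ := (hasBasis_cobounded_norm (E := ℂ)).eventually_iff.1
    (h.and (eventually_mem_offInterval a b))
  have hmem : ((|R| + 1 : ℝ) : ℂ) ∈ {z : ℂ | R < ‖z‖} := by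
    simp only [Set.mem_ofPred_eq, Complex.norm_real, Real.norm_eq_abs]
    rw [abs_of_nonneg (by positivity)]
    linarith [le_abs_self R]
  refine eqOn_offInterval_of_eventuallyEq hF hG (hR (show R ≤ ‖((|R| + 1 : ℝ) : ℂ)‖ from le_of_lt hmem)).2 ?_
  filter_upwards [(isOpen_lt continuous_const continuous_norm).mem_nhds hmem] with z hz
  exact (hR (show R ≤ ‖z‖ from le_of_lt hz)).1

theorem momentRelation_iff_eqOn {a b : ℝ} (hab : a ≤ b) {ψ : Measure ℝ}
    (hψ : ψ ∈ BoundedDensityMeasures a b) {w : ℝ → ℝ} (hw : w ∈ Diagrams a b) :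
    MomentRelation a b ψ w ↔ Set.EqOn (measureR a b ψ) (diagramR a b w) (offInterval a b) := by
  rw [momentRelation_iff_eventually hab hψ hw]
  refine ⟨fun h => eqOn_offInterval_of_eventuallyEq_cobounded ?_
    (differentiableOn_diagramR hab hw) h, fun h => (eventually_mem_offInterval a b).mono h⟩
  obtain ⟨f, hf, h01, -, rfl⟩ := BoundedDensityMeasures.exists_density hψ
  rw [funext fun u =>
    measureR_withDensity (a := a) (b := b) hf (fun x => (h01 x).1) u]
  exact (differentiableOn_const _).add
    (differentiableOn_stieltjes (integrableOn_of_mem_unitInterval hf h01 a b)).cexp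

theorem measure_unique {a b : ℝ} {ψ₁ ψ₂ : Measure ℝ} (h₁ : ψ₁ ∈ BoundedDensityMeasures a b)
    (h₂ : ψ₂ ∈ BoundedDensityMeasures a b)
    (h : Set.EqOn (measureR a b ψ₁) (measureR a b ψ₂) (offInterval a b)) : ψ₁ = ψ₂ := by
  obtain ⟨f, hf, hf01, -, rfl⟩ := BoundedDensityMeasures.exists_density h₁
  obtain ⟨g, hg, hg01, -, rfl⟩ := BoundedDensityMeasures.exists_density h₂
  refine withDensity_congr_ae ((ae_restrict_iff' measurableSet_Icc).2 ?_)
  filter_upwards [ae_eq_of_exp_stieltjes_eq (integrableOn_of_mem_unitInterval hf hf01 a b)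
    (integrableOn_of_mem_unitInterval hg hg01 a b)
    ((eventually_mem_offInterval a b).mono fun u hu => by
      simpa [measureR_withDensity hf fun x => (hf01 x).1,
        measureR_withDensity hg fun x => (hg01 x).1] using h hu)] with t ht htI
  rw [ht htI]

theorem diagram_unique {a b : ℝ} (hab : a ≤ b) {w v : ℝ → ℝ} (hw : w ∈ Diagrams a b)
    (hv : v ∈ Diagrams a b)
    (h : Set.EqOn (diagramR a b w) (diagramR a b v) (offInterval a b)) : w = v :=
  Diagrams.ext_of_slopeDensity hab hw hv (ae_eq_of_exp_stieltjes_eq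
    (integrableOn_slopeDensity (Diagrams.lipschitzWith hw) a b)
    (integrableOn_slopeDensity (Diagrams.lipschitzWith hv) a b)
    ((eventually_mem_offInterval a b).mono fun u hu => by
      rw [← diagramR_mul_sub hab hw hu, ← diagramR_mul_sub hab hv hu, h hu]))

/-! ### From measures to diagrams -/

/-- Every density with values in `[0, 1]` is the slope density of a diagram, centred at
`a + ∫ G`. -/
theorem exists_diagram_slopeDensity {a b : ℝ} (hab : a ≤ b) {G : ℝ → ℝ} (hG : Measurable G)
    (h01 : ∀ t, 0 ≤ G t ∧ G t ≤ 1) :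
    ∃ w ∈ Diagrams a b, ∀ᵐ t : ℝ, t ∈ Set.Icc a b → slopeDensity w t = G t := by
  have hGi := integrableOn_of_mem_unitInterval hG h01 a b
  -- `s` is the prescribed slope, `w(a) = ∫ G` the value that makes the centre `a + ∫ G`
  set s : ℝ → ℝ := fun t => if t < a then -1 else if t ≤ b then 1 - 2 * G t else 1 with hs
  have hsm : Measurable s := Measurable.ite measurableSet_Iio measurable_const
    (Measurable.ite measurableSet_Iic (by fun_prop) measurable_const)
  have hs1 : ∀ t, |s t| ≤ 1 := fun t => by
    have := h01 t
    rw [hs, abs_le]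
    simp only
    split_ifs <;> constructor <;> linarith
  have hsloc : LocallyIntegrable s := (locallyIntegrable_const (1 : ℝ)).mono
    hsm.aestronglyMeasurable (Eventually.of_forall fun t => by simpa using hs1 t)
  have hsi : ∀ x y, IntervalIntegrable s volume x y := fun x y =>
    (hsloc.integrableOn_isCompact isCompact_uIcc).intervalIntegrable
  set m := ∫ t in Set.Icc a b, G t with hm
  have hm0 : 0 ≤ m := setIntegral_nonneg measurableSet_Icc fun t _ => (h01 t).1
  have hm1 : m ≤ b - a := by
    have := setIntegral_mono_on hGi (integrableOn_const (C := (1 : ℝ)) (by simp)) measurableSet_Icc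
      fun t _ => (h01 t).2
    simpa [hab] using this
  set w : ℝ → ℝ := fun x => m + ∫ t in a..x, s t with hw
  have hlip : ∀ x y, |w x - w y| ≤ |x - y| := fun x y => by
    rw [hw]
    simp only
    rw [add_sub_add_left_eq_sub, intervalIntegral.integral_interval_sub_left (hsi _ _) (hsi _ _),
      ← Real.norm_eq_abs, ← one_mul |x - y|]
    exact intervalIntegral.norm_integral_le_of_norm_le_const fun t _ => hs1 t
  have hleft : ∀ x ≤ a, w x = |x - (a + m)| := fun x hx => by
    have : ∫ t in a..x, s t = a - x := by
      rw [intervalIntegral.integral_symm]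
      have : ∫ t in x..a, s t = ∫ t in x..a, (-1 : ℝ) := by
        refine intervalIntegral.integral_congr_ae ?_
        filter_upwards [compl_mem_ae_iff.2 (measure_singleton a)] with t hta ht
        rw [Set.uIoc_of_le hx] at ht
        simp [hs, lt_of_le_of_ne ht.2 hta]
      rw [this, intervalIntegral.integral_const]
      simp
    rw [hw]
    simp only
    rw [this, abs_of_nonpos (by linarith)]
    ring
  have hmid : ∫ t in a..b, s t = (b - a) - 2 * m := by
    have : ∫ t in a..b, s t = ∫ t in a..b, (1 - 2 * G t) := by
      refine intervalIntegral.integral_congr fun t ht => ?_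
      rw [Set.uIcc_of_le hab] at ht
      simp [hs, not_lt.2 ht.1, ht.2]
    have hGii : IntervalIntegrable G volume a b :=
      (intervalIntegrable_iff_integrableOn_Icc_of_le hab).2 hGi
    rw [this, intervalIntegral.integral_sub (by simp) (hGii.const_mul 2),
      intervalIntegral.integral_const_mul, intervalIntegral.integral_of_le hab (f := G),
      ← integral_Icc_eq_integral_Ioc]
    simp [hm]
  have hright : ∀ x, b ≤ x → w x = |x - (a + m)| := fun x hx => by
    have : ∫ t in b..x, s t = x - b := by
      have : ∫ t in b..x, s t = ∫ t in b..x, (1 : ℝ) := by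
        refine intervalIntegral.integral_congr_ae (Eventually.of_forall fun t ht => ?_)
        rw [Set.uIoc_of_le hx] at ht
        simp [hs, not_lt.2 (hab.trans ht.1.le), not_le.2 ht.1]
      rw [this, intervalIntegral.integral_const]
      simp
    rw [hw]
    simp only
    rw [← intervalIntegral.integral_add_adjacent_intervals (hsi a b) (hsi b x), this, hmid,
      abs_of_nonneg (by linarith)]
    ring
  refine ⟨w, ⟨⟨hlip, a + m, max |a| |b|, fun x hx => ?_⟩, a + m, ⟨by linarith, by linarith⟩,
    fun x hx => ?_⟩, ?_⟩
  · by_cases hxa : x ≤ a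
    · exact hleft x hxa
    · refine hright x ?_
      by_contra! hxb
      push Not at hxa
      have h1 := (le_max_left |a| |b|).trans hx
      have h2 := (le_max_right |a| |b|).trans hx
      rcases abs_cases a with ⟨_, _⟩ | ⟨_, _⟩ <;> rcases abs_cases b with ⟨_, _⟩ | ⟨_, _⟩ <;>
        rcases abs_cases x with ⟨_, _⟩ | ⟨_, _⟩ <;> linarith
  · by_cases hxa : x ≤ a
    · exact hleft x hxa
    · exact hright x (not_lt.1 fun hxb => hx ⟨(not_le.1 hxa).le, hxb.le⟩)
  · filter_upwards [LocallyIntegrable.ae_hasDerivAt_integral hsloc] with t ht htI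
    have : deriv w t = s t := ((ht a).const_add m).deriv
    rw [slopeDensity, this, hs]
    simp [not_lt.2 htI.1, htI.2]

theorem setIntegral_mul_pos {a b : ℝ} {g k : ℝ → ℝ} (hg : IntegrableOn g (Set.Icc a b))
    (h0 : ∀ t, 0 ≤ g t) (hpos : 0 < ∫ t in Set.Icc a b, g t) (hk : ContinuousOn k (Set.Icc a b))
    (hk0 : ∀ t ∈ Set.Icc a b, 0 < k t) : 0 < ∫ t in Set.Icc a b, g t * k t := by
  rcases (Set.Icc a b).eq_empty_or_nonempty with he | hne
  · simp [he] at hpos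
  obtain ⟨s, hs, hmin⟩ := isCompact_Icc.exists_isMinOn hne hk
  have hlow : ∫ t in Set.Icc a b, g t * k s ≤ ∫ t in Set.Icc a b, g t * k t :=
    setIntegral_mono_on (hg.mul_const _) (hg.mul_continuousOn hk isCompact_Icc) measurableSet_Icc
      fun t ht => mul_le_mul_of_nonneg_left (hmin ht) (h0 t)
  rw [integral_mul_const] at hlow
  exact (mul_pos hpos (hk0 s hs)).trans_le hlow

theorem stieltjes_im_neg {a b : ℝ} {g : ℝ → ℝ} (hg : IntegrableOn g (Set.Icc a b))
    (h0 : ∀ t, 0 ≤ g t) (hpos : 0 < ∫ t in Set.Icc a b, g t) {u : ℂ} (hu : 0 < u.im) :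
    (stieltjes a b g u).im < 0 := by
  have ho : u ∈ offInterval a b := mem_offInterval_of_im_ne_zero hu.ne'
  have hn : ∀ t ∈ Set.Icc a b, 0 < Complex.normSq (u - t) := fun t ht =>
    Complex.normSq_pos.2 (sub_ne_zero_of_mem_offInterval ho ht)
  rw [stieltjes_im hg ho, neg_lt_zero]
  refine setIntegral_mul_pos hg h0 hpos (continuousOn_const.div ?_ fun t ht => (hn t ht).ne')
    fun t ht => div_pos hu (hn t ht)
  exact (Complex.continuous_normSq.comp (by fun_prop)).continuousOn

/-- On the real axis off `[a, b]` the transform of a nonzero density has the sign of `x - a`. -/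
theorem mul_integral_div_sub_pos {a b : ℝ} {g : ℝ → ℝ} (hg : IntegrableOn g (Set.Icc a b))
    (h0 : ∀ t, 0 ≤ g t) (hpos : 0 < ∫ t in Set.Icc a b, g t) {x : ℝ} (hx : x ∉ Set.Icc a b) :
    0 < (x - a) * ∫ t in Set.Icc a b, g t / (x - t) := by
  have hne : ∀ t ∈ Set.Icc a b, x - t ≠ 0 := fun t ht h => hx (sub_eq_zero.1 h ▸ ht)
  rw [← integral_const_mul]
  have := setIntegral_mul_pos hg h0 hpos (k := fun t => (x - a) / (x - t))
    (continuousOn_const.div (by fun_prop) hne) fun t ht => by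
      rcases lt_or_ge x a with h | h
      · exact div_pos_of_neg_of_neg (by linarith) (by linarith [ht.1])
      · have hb : b < x := not_le.1 fun h' => hx ⟨h, h'⟩
        exact div_pos (by linarith [ht.1, ht.2]) (by linarith [ht.2])
  have he : ∀ t, (x - a) * (g t / (x - t)) = g t * ((x - a) / (x - t)) := fun t =>
    mul_div_left_comm _ _ _
  simpa only [he] using this

theorem exp_im_neg {s : ℂ} (h1 : -Real.pi < s.im) (h2 : s.im < 0) : (Complex.exp s).im < 0 := by
  rw [Complex.exp_im]
  exact mul_neg_of_pos_of_neg (Real.exp_pos _) (Real.sin_neg_of_neg_of_neg_pi_lt h2 h1)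

theorem arg_neg_of_im_neg {z : ℂ} (hz : z.im < 0) :
    -Real.pi < Complex.arg z ∧ Complex.arg z < 0 :=
  ⟨Complex.neg_pi_lt_arg z, Complex.arg_neg_iff.2 hz⟩

/-- `u (exp S(u) - 1)` has the same limit at infinity as `u S(u)`, the total mass of the density. -/
theorem tendsto_mul_exp_stieltjes_sub_one {a b : ℝ} {g : ℝ → ℝ}
    (hg : IntegrableOn g (Set.Icc a b)) :
    Tendsto (fun u => u * (Complex.exp (stieltjes a b g u) - 1)) (Bornology.cobounded ℂ)
      (𝓝 ((∫ t in Set.Icc a b, g t : ℝ) : ℂ)) := by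
  have hd : Tendsto (dslope Complex.exp 0) (𝓝 0) (𝓝 1) := by
    have := (continuousAt_dslope_same.2 (Complex.differentiableAt_exp (x := 0))).tendsto
    rwa [dslope_same, Complex.deriv_exp, Complex.exp_zero] at this
  have h := (tendsto_mul_stieltjes_cobounded hg).mul
    (hd.comp (tendsto_stieltjes_cobounded hg))
  rw [mul_one] at h
  refine h.congr fun u => ?_
  have := sub_smul_dslope Complex.exp 0 (stieltjes a b g u)
  rw [sub_zero, smul_eq_mul, Complex.exp_zero] at this
  rw [Function.comp, mul_assoc, this]

/-- For a density `f` of total mass one, `(u - a) (exp S_f(u) - 1)` takes values in the slit plane: in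
the upper half-plane the arguments of the two factors lie in `(0, π)` and `(-π, 0)`. -/
theorem mul_exp_stieltjes_sub_one_mem_slitPlane {a b : ℝ} (hab : a ≤ b) {f : ℝ → ℝ}
    (hf : IntegrableOn f (Set.Icc a b)) (h01 : ∀ t, 0 ≤ f t ∧ f t ≤ 1)
    (hmass : ∫ t in Set.Icc a b, f t = 1) {u : ℂ} (hu : u ∈ offInterval a b) :
    (u - a) * (Complex.exp (stieltjes a b f u) - 1) ∈ Complex.slitPlane ∧
      (0 < u.im → (Complex.exp (stieltjes a b f u) - 1).im < 0 ∧
        Complex.arg ((u - a) * (Complex.exp (stieltjes a b f u) - 1)) =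
          Complex.arg (u - a) + Complex.arg (Complex.exp (stieltjes a b f u) - 1)) := by
  have hpos : 0 < ∫ t in Set.Icc a b, f t := hmass ▸ one_pos
  have hup : ∀ v : ℂ, 0 < v.im →
      (v - a) * (Complex.exp (stieltjes a b f v) - 1) ∈ Complex.slitPlane ∧
      (Complex.exp (stieltjes a b f v) - 1).im < 0 ∧
        Complex.arg ((v - a) * (Complex.exp (stieltjes a b f v) - 1)) =
          Complex.arg (v - a) + Complex.arg (Complex.exp (stieltjes a b f v) - 1) := by
    intro v hv
    have hva := arg_mem_Ioo_of_im_pos (z := v - a) (by simpa using hv)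
    have hvb := arg_mem_Ioo_of_im_pos (z := v - b) (by simpa using hv)
    have h1 := (stieltjes_im_mem hab hf h01 hv).1
    have h2 := stieltjes_im_neg hf (fun t => (h01 t).1) hpos hv
    have him : (Complex.exp (stieltjes a b f v) - 1).im < 0 := by
      simpa using exp_im_neg (by linarith [hva.1, hvb.2]) h2
    have harg := arg_neg_of_im_neg him
    have hne : Complex.exp (stieltjes a b f v) - 1 ≠ 0 := fun h => by simp [h] at him
    have hne' : v - (a : ℂ) ≠ 0 := fun h => by simp [h] at hva
    have hsum := Complex.arg_mul hne' hne ⟨by linarith [hva.1], by linarith [hva.2]⟩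
    refine ⟨Complex.mem_slitPlane_iff_arg.2 ⟨?_, mul_ne_zero hne' hne⟩, him, hsum⟩
    rw [hsum]
    linarith [hva.2]
  refine ⟨?_, fun h => (hup u h).2⟩
  rcases lt_trichotomy u.im 0 with h | h | h
  · have := (hup (starRingEnd ℂ u) (by simpa using h)).1
    have he : (starRingEnd ℂ u - a) * (Complex.exp (stieltjes a b f (starRingEnd ℂ u)) - 1) =
        starRingEnd ℂ ((u - a) * (Complex.exp (stieltjes a b f u) - 1)) := by
      rw [stieltjes_conj, Complex.exp_conj]
      simp
    rw [he, Complex.mem_slitPlane_iff, Complex.conj_re, Complex.conj_im, neg_ne_zero] at this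
    exact Complex.mem_slitPlane_iff.2 this
  · obtain ⟨x, rfl⟩ : ∃ x : ℝ, u = x := ⟨u.re, Complex.ext rfl (by simp [h])⟩
    have hp := mul_integral_div_sub_pos hf (fun t => (h01 t).1) hpos (ofReal_mem_offInterval.1 hu)
    rw [stieltjes_ofReal]
    set r := ∫ t in Set.Icc a b, f t / (x - t)
    left
    have : ((x : ℂ) - a) * (Complex.exp r - 1) = (((x - a) * (Real.exp r - 1) : ℝ) : ℂ) := by
      push_cast
      rfl
    rw [this, Complex.ofReal_re]
    rcases mul_pos_iff.1 hp with ⟨h1, h2⟩ | ⟨h1, h2⟩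
    · exact mul_pos h1 (sub_pos.2 (Real.one_lt_exp_iff.2 h2))
    · exact mul_pos_of_neg_of_neg h1 (sub_neg.2 (Real.exp_zero ▸ Real.exp_lt_exp.2 h2))
  · exact (hup u h).1

/-- The measure-to-diagram half of the correspondence: the representation theorem applied to
`log ((u - a) R_ψ(u))` yields the slope density of the diagram. -/
theorem exists_diagram {a b : ℝ} (hab : a ≤ b) {ψ : Measure ℝ}
    (hψ : ψ ∈ BoundedDensityMeasures a b) :
    ∃ w ∈ RestrictedDiagrams a b, Set.EqOn (measureR a b ψ) (diagramR a b w) (offInterval a b) := by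
  obtain ⟨f, hfm, h01, hmass, rfl⟩ := BoundedDensityMeasures.exists_density hψ
  have hf := integrableOn_of_mem_unitInterval hfm h01 a b
  have hR := measureR_withDensity (a := a) (b := b) hfm fun x => (h01 x).1
  set T : ℂ → ℂ := fun u => (u - a) * (Complex.exp (stieltjes a b f u) - 1) with hT
  have hTm := fun u (hu : u ∈ offInterval a b) =>
    mul_exp_stieltjes_sub_one_mem_slitPlane hab hf h01 hmass hu
  have hup : ∀ {u : ℂ}, 0 < u.im → u ∈ offInterval a b := fun h =>
    mem_offInterval_of_im_ne_zero h.ne'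
  have hTd : DifferentiableOn ℂ T (offInterval a b) :=
    (by fun_prop : DifferentiableOn ℂ (fun u : ℂ => u - a) _).mul
      ((differentiableOn_stieltjes hf).cexp.sub_const 1)
  have hT1 : Tendsto T (Bornology.cobounded ℂ) (𝓝 1) := by
    have h1 := tendsto_mul_exp_stieltjes_sub_one hf
    have h2 : Tendsto (fun u => (a : ℂ) * (Complex.exp (stieltjes a b f u) - 1))
        (Bornology.cobounded ℂ) (𝓝 0) := by
      have := (((Complex.continuous_exp.tendsto 0).comp
        (tendsto_stieltjes_cobounded hf)).sub_const 1).const_mul (a : ℂ)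
      simpa using this
    have := h1.sub h2
    rw [hmass, Complex.ofReal_one, sub_zero] at this
    exact this.congr fun u => by
      simp only [hT]
      ring
  obtain ⟨G, hG, hG01, hLG⟩ := exists_density_eq_stieltjes (a := a) (b := b)
    (L := fun u => Complex.log (T u)) (C := Real.pi)
    (hTd.clog fun u hu => (hTm u hu).1)
    (by
      have := ((continuousAt_clog (x := 1) (by simp)).tendsto).comp hT1
      rwa [Complex.log_one] at this)
    (fun x hx => by
      have ho := ofReal_mem_offInterval.2 hx
      have h1 : T x = ((x - a) * (Real.exp (∫ t in Set.Icc a b, f t / (x - t)) - 1) : ℝ) := by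
        simp only [hT, stieltjes_ofReal]
        push_cast
        rfl
      have h2 := (hTm x ho).1
      change T x ∈ _ at h2
      rw [h1, Complex.ofReal_mem_slitPlane] at h2
      rw [h1, Complex.log_im, Complex.arg_ofReal_of_nonneg h2.le])
    (fun z _ => by
      rw [Complex.log_im]
      exact Complex.abs_arg_le_pi _)
    (fun t ht δ hδ => by
      have ha : Tendsto (fun ε : ℝ => Complex.arg ((t : ℂ) + ε * Complex.I - a)) (𝓝 0) (𝓝 0) := by
        have hm : ((t : ℂ) - a) ∈ Complex.slitPlane := by
          rw [← Complex.ofReal_sub, Complex.ofReal_mem_slitPlane]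
          exact sub_pos.2 ht.1
        have h0 : Complex.arg ((t : ℂ) - a) = 0 := by
          rw [← Complex.ofReal_sub, Complex.arg_ofReal_of_nonneg (sub_pos.2 ht.1).le]
        have h1 : Tendsto (fun ε : ℝ => (t : ℂ) + ε * Complex.I - a) (𝓝 0) (𝓝 ((t : ℂ) - a)) :=
          Continuous.tendsto' (by fun_prop) _ _ (by simp)
        have := (Complex.continuousAt_arg hm).tendsto.comp h1
        rwa [h0] at this
      filter_upwards [nhdsWithin_le_nhds (ha.eventually_lt_const hδ), self_mem_nhdsWithin]
        with ε hε1 hε0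
      have him : 0 < ((t : ℂ) + ε * Complex.I).im := by simpa using hε0
      obtain ⟨h1, h2⟩ := (hTm _ (hup him)).2 him
      have h3 := arg_neg_of_im_neg h1
      have h4 := arg_mem_Ioo_of_im_pos (z := (t : ℂ) + ε * Complex.I - a) (by simpa using him)
      rw [Complex.log_im]
      simp only [hT]
      rw [h2]
      constructor <;> linarith [h4.1])
  obtain ⟨w, hw, hwG⟩ := exists_diagram_slopeDensity hab hG hG01
  have hEq : Set.EqOn (measureR a b ((volume.restrict (Set.Icc a b)).withDensity
      (fun x => ENNReal.ofReal (f x)))) (diagramR a b w) (offInterval a b) := by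
    intro u hu
    have h1 := diagramR_mul_sub hab hw hu
    have h2 : stieltjes a b (slopeDensity w) u = stieltjes a b G u :=
      setIntegral_congr_ae measurableSet_Icc (hwG.mono fun t ht htI => by rw [ht htI])
    have hne : u - (a : ℂ) ≠ 0 := sub_ne_zero_of_mem_offInterval hu (Set.left_mem_Icc.2 hab)
    rw [h2, ← hLG hu, Complex.exp_log (Complex.slitPlane_ne_zero (hTm u hu).1)] at h1
    refine mul_right_cancel₀ hne ?_
    rw [h1, hR]
    ring
  refine ⟨w, ⟨hw, fun x hx => ?_⟩, hEq⟩
  rw [← hEq (ofReal_mem_offInterval.2 hx), hR, stieltjes_ofReal, ← Complex.ofReal_exp]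
  rw [Complex.add_re, Complex.neg_re, Complex.one_re, Complex.ofReal_re]
  linarith [Real.exp_pos (∫ t in Set.Icc a b, f t / (x - t))]

/-! ### From diagrams to measures -/

/-- The diagram-to-measure half of the correspondence: the representation theorem applied to
`log (1 + R_w(u))` yields the density of the measure. The bound `R_w > -1` on the real axis keeps
`1 + R_w` in the slit plane there. -/
theorem exists_measure {a b : ℝ} (hab : a ≤ b) {w : ℝ → ℝ} (hwr : w ∈ RestrictedDiagrams a b) :
    ∃ ψ ∈ BoundedDensityMeasures a b, Set.EqOn (measureR a b ψ) (diagramR a b w) (offInterval a b) := by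
  obtain ⟨hw, hgt⟩ := hwr
  have hwl := Diagrams.lipschitzWith hw
  have hg := integrableOn_slopeDensity hwl a b
  have hg01 := slopeDensity_mem hwl
  set S := stieltjes a b (slopeDensity w) with hS
  have hne : ∀ u ∈ offInterval a b, u - (a : ℂ) ≠ 0 := fun u hu =>
    sub_ne_zero_of_mem_offInterval hu (Set.left_mem_Icc.2 hab)
  have hRS : ∀ u ∈ offInterval a b, diagramR a b w u = Complex.exp (S u) / (u - a) := fun u hu =>
    (eq_div_iff (hne u hu)).2 (diagramR_mul_sub hab hw hu)
  have him : ∀ u : ℂ, 0 < u.im → (1 + diagramR a b w u).im < 0 := by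
    intro u hu
    have ho : u ∈ offInterval a b := mem_offInterval_of_im_ne_zero hu.ne'
    have ha := arg_mem_Ioo_of_im_pos (z := u - a) (by simpa using hu)
    have hb := arg_mem_Ioo_of_im_pos (z := u - b) (by simpa using hu)
    have h1 := stieltjes_im_mem hab hg hg01 hu
    -- by `h1` the exponent has imaginary part between `-arg (u - b) > -π` and `-arg (u - a) < 0`
    have h2 : diagramR a b w u = Complex.exp (S u - Complex.log (u - a)) := by
      rw [hRS u ho, Complex.exp_sub, Complex.exp_log (hne u ho)]
    rw [h2, Complex.add_im, Complex.one_im, zero_add]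
    refine exp_im_neg ?_ ?_ <;> rw [Complex.sub_im, Complex.log_im] <;>
      linarith [ha.1, hb.2, h1.1, h1.2]
  have hreal : ∀ x : ℝ, x ∉ Set.Icc a b →
      ∃ r : ℝ, 0 < r ∧ 1 + diagramR a b w x = r := fun x hx =>
    ⟨1 + (diagramR a b w x).re, by linarith [hgt x hx],
      Complex.ext (by simp) (by simp [diagramR_ofReal_im])⟩
  have hslit : ∀ u ∈ offInterval a b, 1 + diagramR a b w u ∈ Complex.slitPlane := by
    intro u hu
    rcases lt_trichotomy u.im 0 with h | h | h
    · have h1 := him (starRingEnd ℂ u) (by simpa using h)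
      have hu' : starRingEnd ℂ u ∈ offInterval a b :=
        mem_offInterval_of_im_ne_zero (by simpa using h.ne)
      have h2 : diagramR a b w (starRingEnd ℂ u) = starRingEnd ℂ (diagramR a b w u) := by
        rw [hRS u hu, hRS _ hu', hS, stieltjes_conj, Complex.exp_conj]
        simp
      rw [h2] at h1
      right
      simp at h1 ⊢
      exact h1.ne'
    · obtain ⟨x, rfl⟩ : ∃ x : ℝ, u = x := ⟨u.re, Complex.ext rfl (by simp [h])⟩
      obtain ⟨r, hr, he⟩ := hreal x (ofReal_mem_offInterval.1 hu)
      rw [he, Complex.ofReal_mem_slitPlane]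
      exact hr
    · exact Or.inr (him u h).ne
  have hexpS : Tendsto (fun u => Complex.exp (S u)) (Bornology.cobounded ℂ) (𝓝 1) := by
    have := (Complex.continuous_exp.tendsto 0).comp (tendsto_stieltjes_cobounded hg)
    rwa [Complex.exp_zero] at this
  have hinv : Tendsto (fun u : ℂ => (u - a)⁻¹) (Bornology.cobounded ℂ) (𝓝 0) :=
    tendsto_inv₀_cobounded.comp (tendsto_sub_const_cobounded _)
  have hR0 : Tendsto (diagramR a b w) (Bornology.cobounded ℂ) (𝓝 0) := by
    have := hexpS.mul hinv
    rw [mul_zero] at this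
    refine this.congr' ?_
    filter_upwards [eventually_mem_offInterval a b] with u hu
    rw [hRS u hu, div_eq_mul_inv]
  have hmassR : Tendsto (fun u => u * diagramR a b w u) (Bornology.cobounded ℂ) (𝓝 1) := by
    have := hexpS.add (hR0.const_mul (a : ℂ))
    rw [mul_zero, add_zero] at this
    refine this.congr' ?_
    filter_upwards [eventually_mem_offInterval a b] with u hu
    rw [hS, ← diagramR_mul_sub hab hw hu]
    ring
  obtain ⟨f, hfm, hf01, hLf⟩ := exists_density_eq_stieltjes (a := a) (b := b)
    (L := fun u => Complex.log (1 + diagramR a b w u)) (C := Real.pi)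
    (((differentiableOn_diagramR hab hw).const_add 1).clog hslit)
    (by
      have h1 : Tendsto (fun u => 1 + diagramR a b w u) (Bornology.cobounded ℂ) (𝓝 1) := by
        simpa using hR0.const_add 1
      have := ((continuousAt_clog (x := 1) (by simp)).tendsto).comp h1
      rwa [Complex.log_one] at this)
    (fun x hx => by
      obtain ⟨r, hr, he⟩ := hreal x hx
      rw [he, Complex.log_im, Complex.arg_ofReal_of_nonneg hr.le])
    (fun z _ => by
      rw [Complex.log_im]
      exact Complex.abs_arg_le_pi _)
    (fun t _ δ hδ => by
      filter_upwards [self_mem_nhdsWithin] with ε hε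
      have := arg_neg_of_im_neg (him (t + ε * Complex.I) (by simpa using hε))
      rw [Complex.log_im]
      constructor <;> linarith)
  have hf := integrableOn_of_mem_unitInterval hfm hf01 a b
  have hexp : ∀ u ∈ offInterval a b, -1 + Complex.exp (stieltjes a b f u) = diagramR a b w u :=
    fun u hu => by
      rw [← hLf hu, Complex.exp_log (Complex.slitPlane_ne_zero (hslit u hu))]
      ring
  have hmass : ∫ t in Set.Icc a b, f t = 1 := by
    have h1 := tendsto_mul_exp_stieltjes_sub_one hf
    have h2 := hmassR.congr' (f₂ := fun u => u * (Complex.exp (stieltjes a b f u) - 1)) (by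
      filter_upwards [eventually_mem_offInterval a b] with u hu
      rw [← hexp u hu]
      ring)
    exact_mod_cast tendsto_nhds_unique h1 h2
  refine ⟨(volume.restrict (Set.Icc a b)).withDensity (fun x => ENNReal.ofReal (f x)),
    ⟨⟨?_⟩, ?_, (Set.Icc a b).indicator f, hfm.indicator measurableSet_Icc, fun x => ?_, ?_⟩,
    fun u hu => ?_⟩
  · rw [withDensity_apply _ MeasurableSet.univ, Measure.restrict_univ,
      ← ofReal_integral_eq_lintegral_ofReal hf (Eventually.of_forall fun x => (hf01 x).1), hmass,
      ENNReal.ofReal_one]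
  · rw [withDensity_apply _ measurableSet_Icc.compl, Measure.restrict_restrict measurableSet_Icc.compl]
    simp
  · by_cases hx : x ∈ Set.Icc a b
    · simpa only [Set.indicator_of_mem hx] using hf01 x
    · simp [hx]
  · rw [← withDensity_indicator measurableSet_Icc]
    congr 1 with x
    by_cases hx : x ∈ Set.Icc a b <;> simp [hx]
  · rw [measureR_withDensity hfm fun x => (hf01 x).1, hexp u hu]

/-! ### The bijection -/

theorem mainTheorem2 (a b : ℝ) (hab : a ≤ b) :
    (∃ Φ : BoundedDensityMeasures a b ≃ RestrictedDiagrams a b,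
      ∀ (ψ : BoundedDensityMeasures a b) (w : RestrictedDiagrams a b),
        Φ ψ = w ↔ MomentRelation a b (ψ : Measure ℝ) (w : ℝ → ℝ)) ∧
    ∀ ψ ∈ BoundedDensityMeasures a b, ∀ w ∈ RestrictedDiagrams a b,
      MomentRelation a b ψ w ↔
        ∀ u : ℂ, u ∉ ((fun t : ℝ => (t : ℂ)) '' Set.Icc a b) →
          measureR a b ψ u = diagramR a b w u := by
  refine ⟨?_, fun ψ hψ w hw => momentRelation_iff_eqOn hab hψ hw.1⟩
  choose! F hF hFR using fun ψ (hψ : ψ ∈ BoundedDensityMeasures a b) => exists_diagram hab hψ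
  have hiff : ∀ ψ ∈ BoundedDensityMeasures a b, ∀ w ∈ RestrictedDiagrams a b,
      F ψ = w ↔ Set.EqOn (measureR a b ψ) (diagramR a b w) (offInterval a b) := fun ψ hψ w hw =>
    ⟨fun h => h ▸ hFR ψ hψ,
      fun h => diagram_unique hab (hF ψ hψ).1 hw.1 ((hFR ψ hψ).symm.trans h)⟩
  let Φ : BoundedDensityMeasures a b → RestrictedDiagrams a b := fun ψ => ⟨F ψ, hF ψ ψ.2⟩
  have hΦ : Function.Bijective Φ := by
    constructor
    · intro ψ₁ ψ₂ h
      have h' : F ψ₁ = F ψ₂ := congrArg Subtype.val h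
      exact Subtype.ext (measure_unique ψ₁.2 ψ₂.2
        (((hiff _ ψ₁.2 _ (hF _ ψ₂.2)).1 h').trans (hFR _ ψ₂.2).symm))
    · intro w
      obtain ⟨ψ, hψ, h⟩ := exists_measure hab w.2
      exact ⟨⟨ψ, hψ⟩, Subtype.ext ((hiff ψ hψ _ w.2).2 h)⟩
  refine ⟨Equiv.ofBijective Φ hΦ, fun ψ w => ?_⟩
  rw [momentRelation_iff_eqOn hab ψ.2 w.2.1, ← hiff ψ ψ.2 w w.2, Equiv.ofBijective_apply,
    Subtype.ext_iff]
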